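/- **Conventions.** Let $n\ge 1$, let $M$ be a closed oriented smooth $n$-manifold and $(X;*)$ a quandle (right self-distributive: $(a*b)*c=(a*c)*(b*c)$, all maps $a\mapsto a*b$ bijective, $a*a=a$). Put $C^R_k(X)=\mathbb Z X^k$, with $$\partial_k(x_1,\dots,x_k)=\sum_{i=1}^{k}(-1)^i\bigl((x_1,\dots,x_{i-1},x_{i+1},\dots,x_k)-(x_1*x_i,\dots,x_{i-1}*x_i,x_{i+1},\dots,x_k)\bigr)$$ (the term $i=1$ vanishes), let $C^D_k(X)$ be spanned by the tuples with $x_{i+1}=x_i$ for some $i$, let $C^Q_*(X)=C^R_*(X)/C^D_*(X)$, and let $H^Q_*(X)$ be its homology. Let $f:M\to\mathbb R^{n+2}$ be a smooth embedding with regular projection $\pi f:M\to\mathbb R^{n+1}$, where $\pi$ forgets the last coordinate, and $D_M$ its diagram. (Of regularity it is only used that immersed sheets cross normally, that the multiplicity over the image of a branch point is at most $n-1$, and that there are finitely many points of multiplicity at least $n+1$.) Sheets are co-oriented by the orientation of $M$: (positive tangent frame, normal) is positive in $\mathbb R^{n+1}$. The lower decker set $D_-\subset M$ is the closure of the set of points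 that have another point of $M$ above them. A coloring $\phi$ assigns an element of $X$ to each component (region) of $M-D_-$ so that, if the regions $R_1,R_2$ meet along a double point stratum whose upper sheet lies in $R_3$ and whose upper normal points from $R_1$ to $R_2$, then $\phi(R_1)*\phi(R_3)=\phi(R_2)$. A shadow coloring $\tilde\phi$ colors in addition the components (chambers) of $\mathbb R^{n+1}-\pi f(M)$ so that, if the normal of a sheet $\alpha$ points from the chamber $R_1$ to the chamber $R_2$, then $\tilde\phi(R_1)*\tilde\phi(\alpha)=\tilde\phi(R_2)$. At a crossing $p$ of multiplicity $n+1$, let $\operatorname{sgn}(p)$ be the sign of the determinant of the $n+1$ normals listed from the highest to the lowest sheet, let $q_0$ be the color of the source chamber (the one from which all normals point), and let $q_1,\dots,q_{n+1}$ be the colors, next to the source chamber, of the sheets from the lowest to the highest. Put $c_{n+1}(D_M,\phi)=\sum_p\operatorname{sgn}(p)(q_1,\dots,q_{n+1})$ and $c_{n+2}(D_M,\tilde\phi)=\sum_p\operatorname{sgn}(p)(q_0,q_1,\dots,q_{n+1})$. A *pass move* $R\in S(c,n+2,0)$ from $D_M$ to a regular diagram $RD_M$ is a smooth isotopy of knottings,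 with time $\tau\in[-1,1]$, supported over a compact subset $K$ of an open ball $U\subset\mathbb R^{n+1}$. Its track over $U$ consists of $n+2$ co-oriented sheets, numbered from the lowest to the highest. In orientation preserving coordinates $U\cong\mathbb R^{n+1}$ that depend smoothly on $\tau$, these sheets are at time $\tau$ the slices of $n+2$ co-oriented linear hyperplanes $V_1,\dots,V_{n+2}$ of $\mathbb R^{n+1}\times\mathbb R$ with linearly independent normals, any $n+1$ of which also have linearly independent spatial parts. So the sheets meet only in the point $p=0$ of multiplicity $n+2$, at $\tau=0$. Colorings $\phi$ of $D_M$ and $R_\#(\phi)$ of $RD_M$ (and likewise shadow colorings) correspond if they agree outside $K$. The label $q_{sh}(p)=(q_0,q_1,\dots,q_{n+2})$ is formed by the color $q_0$ of the source chamber of $p$, that is, of the points of $U$, at $\tau=-1$ or $\tau=1$, on the source side of all sheets, and by the colors $q_i$ of the points of the $i$-th sheet, at $\tau=-1$ or $\tau=1$, on the source side of all other sheets; and $q(p)=(q_1,\dots,q_{n+2})$. **Lemma 4.2.** Let $R\in S(c,n+2,0)$ be a pass move from $D_M$ to $RD_M$. 1. Let $\phi$ be a coloring of $D_M$ and $R_\#(\phi)$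 the corresponding coloring of $RD_M$. Then $q(p)$ is well defined (it exists and is unique), and $$c_{n+1}(D_M,\phi)-c_{n+1}(RD_M,R_\#(\phi))=\pm\,\partial_{n+2}(q(p))\quad\text{in } C^R_{n+1}(X),$$ with a sign that does not depend on $\phi$. Hence $c_{n+1}(D_M,\phi)$ and $c_{n+1}(RD_M,R_\#(\phi))$ are homologous in $C^Q_*(X)$; as cycles, they have the same class in $H^Q_{n+1}(X)$. 2. Let $\tilde\phi$ be a shadow coloring of $D_M$ and $R_\#(\tilde\phi)$ the corresponding shadow coloring of $RD_M$. Then $q_{sh}(p)$ is well defined, and $$c_{n+2}(D_M,\tilde\phi)-c_{n+2}(RD_M,R_\#(\tilde\phi))=\pm\,\partial_{n+3}(q_{sh}(p))\quad\text{in } C^R_{n+2}(X),$$ with a sign that does not depend on $\tilde\phi$. Hence $c_{n+2}(D_M,\tilde\phi)$ and $c_{n+2}(RD_M,R_\#(\tilde\phi))$ are homologous in $C^Q_*(X)$; as cycles, they have the same class in $H^Q_{n+2}(X)$. -/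

import Mathlib

open scoped Manifold ContDiff Topology

noncomputable section

namespace PassMoveLemma

/-! ### Rack and quandle chain complexes -/

/-- The right operation `a * b` of a rack. Mathlib racks are left distributive, `b ◃ a` being the
action of `b` on `a`, so `a * b` is `b ◃ a`; then `(a * b) * c = (a * c) * (b * c)`, right
multiplications are bijections, and `a * a = a` in a quandle. -/
def rmul {X : Type*} [Shelf X] (a b : X) : X := Shelf.act b a

local infixl:70 " ⋆ " => rmul

/-- The rack chain group `C^R_k(X) = ℤ X^k`. -/
abbrev RackChain (X : Type*) (k : ℕ) : Type _ := (Fin k → X) →₀ ℤ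

/-- The face `d_i^{(*₀)}`: delete the `i`-th coordinate. -/
def faceZero {X : Type*} {k : ℕ} (i : Fin (k + 1)) (x : Fin (k + 1) → X) : Fin k → X :=
  fun j => x (i.succAbove j)

/-- The face `d_i^{(*)}`: delete the `i`-th coordinate and multiply all earlier coordinates
by it on the right. -/
def faceStar {X : Type*} [Shelf X] {k : ℕ} (i : Fin (k + 1)) (x : Fin (k + 1) → X) : Fin k → X :=
  fun j => if j.castSucc < i then x (i.succAbove j) ⋆ x i else x (i.succAbove j)

/-- The boundary of a generator. Coordinates are numbered from `0` here, so the
coordinate `i` is the `(i + 1)`-st one; the term of the first coordinate vanishes, because its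
two faces coincide. -/
def boundaryGen {X : Type*} [Shelf X] {k : ℕ} (x : Fin (k + 1) → X) : RackChain X k :=
  ∑ i : Fin (k + 1), ((-1 : ℤ) ^ ((i : ℕ) + 1)) •
    (Finsupp.single (faceZero i x) (1 : ℤ) - Finsupp.single (faceStar i x) (1 : ℤ))

/-- The rack boundary `∂_{k+1} : C^R_{k+1}(X) → C^R_k(X)`. -/
def boundary (X : Type*) [Shelf X] (k : ℕ) : RackChain X (k + 1) →ₗ[ℤ] RackChain X k :=
  Finsupp.linearCombination ℤ boundaryGen

/-- The degenerate chains `C^D_k(X)`, spanned by the tuples with two equal adjacent entries. -/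
def degenerate (X : Type*) (k : ℕ) : Submodule ℤ (RackChain X k) :=
  Submodule.span ℤ {c | ∃ x : Fin k → X,
    (∃ i j : Fin k, (i : ℕ) + 1 = j ∧ x i = x j) ∧ c = Finsupp.single x 1}

theorem rmul_self {X : Type*} [Quandle X] (a : X) : a ⋆ a = a := Quandle.fix

theorem succAbove_adj {k : ℕ} {i : Fin (k + 1)} {a b : Fin (k + 1)} (hab : (a : ℕ) + 1 = b)
    (ha : a ≠ i) (hb : b ≠ i) :
    ∃ a' b' : Fin k, (a' : ℕ) + 1 = b' ∧ i.succAbove a' = a ∧ i.succAbove b' = b ∧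
      (a'.castSucc < i ↔ b'.castSucc < i) := by
  obtain ⟨a', rfl⟩ := Fin.exists_succAbove_eq ha
  obtain ⟨b', rfl⟩ := Fin.exists_succAbove_eq hb
  refine ⟨a', b', ?_, rfl, rfl, ?_⟩ <;>
  · simp only [Fin.succAbove, Fin.lt_def] at *
    split_ifs at * <;> simp [Fin.ext_iff] at * <;> omega

theorem boundaryGen_degenerate {X : Type*} [Quandle X] {k : ℕ} (x : Fin (k + 1) → X)
    {a b : Fin (k + 1)} (hab : (a : ℕ) + 1 = b) (hx : x a = x b) :
    boundaryGen x ∈ degenerate X k := by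
  classical
  have hne : a ≠ b := by intro h; rw [h] at hab; omega
  have hzero : faceZero a x = faceZero b x := by
    funext j
    by_cases hj : (j : ℕ) = a
    · have h1 : a.succAbove j = b := by
        simp only [Fin.succAbove, Fin.lt_def]
        split_ifs <;> simp [Fin.ext_iff] at * <;> omega
      have h2 : b.succAbove j = a := by
        simp only [Fin.succAbove, Fin.lt_def]
        split_ifs <;> simp [Fin.ext_iff] at * <;> omega
      simp only [faceZero, h1, h2, hx]
    · have h1 : a.succAbove j = b.succAbove j := by
        simp only [Fin.succAbove, Fin.lt_def]
        split_ifs <;> simp [Fin.ext_iff] at * <;> omega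
      simp only [faceZero, h1]
  have hstar : faceStar a x = faceStar b x := by
    funext j
    have hz := congrFun hzero j
    simp only [faceZero] at hz
    by_cases hj : (j : ℕ) = a
    · have h2 : b.succAbove j = a := by
        simp only [Fin.succAbove, Fin.lt_def]
        split_ifs <;> simp [Fin.ext_iff] at * <;> omega
      have c1 : ¬ j.castSucc < a := by simp [Fin.lt_def]; omega
      have c2 : j.castSucc < b := by simp [Fin.lt_def]; omega
      simp only [faceStar, c1, c2, if_true, if_false, hz, h2]
      rw [hx, rmul_self]
    · have c : j.castSucc < a ↔ j.castSucc < b := by simp [Fin.lt_def]; omega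
      simp only [faceStar, c, hz, hx]
  have hother : ∀ i : Fin (k + 1), i ≠ a → i ≠ b →
      ((-1 : ℤ) ^ ((i : ℕ) + 1)) •
        (Finsupp.single (faceZero i x) (1 : ℤ) - Finsupp.single (faceStar i x) (1 : ℤ))
          ∈ degenerate X k := by
    intro i hia hib
    obtain ⟨a', b', h1, h2, h3, h4⟩ := succAbove_adj (i := i) hab hia.symm hib.symm
    refine Submodule.smul_mem _ _ (Submodule.sub_mem _ (Submodule.subset_span ?_)
      (Submodule.subset_span ?_))
    · exact ⟨_, ⟨a', b', h1, by simp only [faceZero, h2, h3, hx]⟩, rfl⟩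
    · exact ⟨_, ⟨a', b', h1, by simp only [faceStar, h2, h3, hx, h4]⟩, rfl⟩
  unfold boundaryGen
  rw [← Finset.add_sum_erase _ _ (Finset.mem_univ a),
    ← Finset.add_sum_erase _ _ (Finset.mem_erase.2 ⟨hne.symm, Finset.mem_univ b⟩), ← add_assoc]
  refine Submodule.add_mem _ ?_ (Submodule.sum_mem _ fun i hi => ?_)
  · rw [hzero, hstar, ← add_smul]
    have : ((-1 : ℤ) ^ ((a : ℕ) + 1) + (-1 : ℤ) ^ ((b : ℕ) + 1)) = 0 := by
      rw [← hab]; ring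
    rw [this, zero_smul]
    exact Submodule.zero_mem _
  · simp only [Finset.mem_erase, Finset.mem_univ, and_true] at hi
    exact hother i hi.2 hi.1

theorem boundary_degenerate (X : Type*) [Quandle X] (k : ℕ) :
    degenerate X (k + 1) ≤ (degenerate X k).comap (boundary X k) := by
  refine Submodule.span_le.2 ?_
  rintro c ⟨x, ⟨a, b, hab, hx⟩, rfl⟩
  simp only [Submodule.comap_coe, Set.mem_preimage, SetLike.mem_coe, boundary,
    Finsupp.linearCombination_single, one_smul]
  exact boundaryGen_degenerate x hab hx

/-- The quandle chain group `C^Q_k(X) = C^R_k(X) / C^D_k(X)`. -/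
abbrev QuandleChain (X : Type*) (k : ℕ) : Type _ := RackChain X k ⧸ degenerate X k

/-- The class of a rack chain in the quandle chain group. -/
def toQuandleChain {X : Type*} {k : ℕ} (c : RackChain X k) : QuandleChain X k :=
  (degenerate X k).mkQ c

/-- The quandle boundary `∂_{k+1} : C^Q_{k+1}(X) → C^Q_k(X)`. -/
def boundaryQ (X : Type*) [Quandle X] (k : ℕ) :
    QuandleChain X (k + 1) →ₗ[ℤ] QuandleChain X k :=
  Submodule.mapQ _ _ (boundary X k) (boundary_degenerate X k)

/-- The quandle homology `H^Q_{k+1}(X)`: cycles modulo boundaries in degree `k + 1`. -/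
abbrev QuandleHomology (X : Type*) [Quandle X] (k : ℕ) : Type _ :=
  LinearMap.ker (boundaryQ X k) ⧸
    (LinearMap.range (boundaryQ X (k + 1))).comap (LinearMap.ker (boundaryQ X k)).subtype

/-- `c` is a cycle in `C^Q_{k+1}(X)`. -/
def IsQuandleCycle {X : Type*} [Quandle X] {k : ℕ} (c : RackChain X (k + 1)) : Prop :=
  toQuandleChain c ∈ LinearMap.ker (boundaryQ X k)

/-- The homology class in `H^Q_{k+1}(X)` of a cycle. -/
def homologyClass {X : Type*} [Quandle X] {k : ℕ} (c : RackChain X (k + 1))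
    (hc : IsQuandleCycle c) : QuandleHomology X k :=
  Submodule.Quotient.mk ⟨toQuandleChain c, hc⟩

/-- `c` and `c'` are homologous in the quandle complex: their difference is a boundary there. -/
def QuandleHomologous {X : Type*} [Quandle X] {k : ℕ} (c c' : RackChain X (k + 1)) : Prop :=
  toQuandleChain c - toQuandleChain c' ∈ LinearMap.range (boundaryQ X (k + 1))

/-! ### Knottings and their projections -/

/-- Euclidean space `ℝ^k`. -/
abbrev E (k : ℕ) : Type := EuclideanSpace ℝ (Fin k)

/-- The projection `π : ℝ^{n+2} → ℝ^{n+1}` onto the first `n + 1` coordinates. -/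
def proj {n : ℕ} (v : E (n + 2)) : E (n + 1) := WithLp.toLp 2 fun i => v i.castSucc

/-- The last coordinate, which decides over and under. -/
def height {n : ℕ} (v : E (n + 2)) : ℝ := v (Fin.last (n + 1))

section Manifold

variable {n : ℕ} {M : Type*} [TopologicalSpace M] [ChartedSpace (E n) M] [IsManifold (𝓡 n) ∞ M]

/-- An orientation of `M`. `sign x = 1` means that the standard basis of
`T_x M = ℝ^n` (the identification being the one of the preferred chart at `x`) is positive, and
`sign x = -1` that it is negative. The condition says that, near `x`, the orientations of the
tangent spaces agree when they are compared through the chart at `x`. -/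
structure ManifoldOrientation (n : ℕ) (M : Type*) [TopologicalSpace M] [ChartedSpace (E n) M]
    [IsManifold (𝓡 n) ∞ M] where
  sign : M → ℤˣ
  locally_constant : ∀ x : M, ∀ᶠ z in 𝓝 x,
    0 < (((sign z * sign x : ℤˣ) : ℤ) : ℝ) * (tangentCoordChange (𝓡 n) z x z).det

/-- The composition `π f : M → ℝ^{n+1}`. -/
def shadowMap (f : M → E (n + 2)) (x : M) : E (n + 1) := proj (f x)

/-- The derivative of `π f` at `x` on the `j`-th standard basis vector of `T_x M`. -/
def tangentVec (f : M → E (n + 2)) (x : M) (j : Fin n) : E (n + 1) :=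
  mfderiv (𝓡 n) 𝓘(ℝ, E (n + 1)) (shadowMap f) x (EuclideanSpace.single j (1 : ℝ) : E n)

/-- The oriented normal vector of the sheet of `π f` through `x`, up to a positive factor: the
generalized cross product of the images of a positive basis `v₁, …, v_n` of `T_x M`. It is
orthogonal to the image of `T_x M`, it is zero exactly if `π f` is not an
immersion at `x`, and otherwise `(v₁, …, v_n, normal)` is a positive basis of `ℝ^{n+1}`. -/
def normal (o : ManifoldOrientation n M) (f : M → E (n + 2)) (x : M) : E (n + 1) :=
  WithLp.toLp 2 fun k => (((o.sign x : ℤˣ) : ℤ) : ℝ) *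
    Matrix.det (Matrix.of (fun i : Fin (n + 1) => fun l : Fin (n + 1) =>
      (Fin.snoc (α := fun _ => E (n + 1)) (tangentVec f x)
        (EuclideanSpace.single k (1 : ℝ)) i : E (n + 1)) l))

/-- The fibre of `π f` over `y`. -/
def fibre (f : M → E (n + 2)) (y : E (n + 1)) : Set M := {x | shadowMap f x = y}

/-- A smooth `n`-knotting. -/
def IsKnotting (f : M → E (n + 2)) : Prop :=
  Manifold.IsSmoothEmbedding (𝓡 n) 𝓘(ℝ, E (n + 2)) ∞ f

/-- Regularity of the projection of `f`. These are the features of a projection in general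
position on which the definition of the chains relies; every projection in general position has
them (over a point with `i` immersed and `j` branch points in its fibre, the codimensions add up
to `i + 3 j ≤ n + 1`, and the points of multiplicity `n + 1` form a compact stratum of dimension
zero).
* The immersed sheets through a point cross normally.
* Over the image of a branch point, the multiplicity is at most `n - 1`.
* There are only finitely many points of multiplicity at least `n + 1`. -/
structure IsRegular (o : ManifoldOrientation n M) (f : M → E (n + 2)) : Prop where
  normal_crossings : ∀ y : E (n + 1), LinearIndependent ℝ
    (fun x : {x : M // shadowMap f x = y ∧ normal o f x ≠ 0} => normal o f x.1)
  branch : ∀ x : M, normal o f x = 0 → (fibre f (shadowMap f x)).encard < n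
  finite_crossings :
    {y : E (n + 1) | ((n + 1 : ℕ) : ℕ∞) ≤ (fibre f y).encard}.Finite

/-- The lower decker set `D_-`: the closure of the set of the points of `M` that have another
point of `M` above them. -/
def lowerDecker (f : M → E (n + 2)) : Set M :=
  closure {x | ∃ x', shadowMap f x' = shadowMap f x ∧ height (f x) < height (f x')}

/-- The `n`-regions: the connected components of `M - D_-`. -/
abbrev Region (f : M → E (n + 2)) : Type _ := ConnectedComponents {x : M // x ∉ lowerDecker f}

/-- The chambers: the connected components of `ℝ^{n+1} - π f (M)`. -/
abbrev Chamber (f : M → E (n + 2)) : Type _ :=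
  ConnectedComponents {y : E (n + 1) // y ∉ Set.range (shadowMap f)}

/-- The region that contains `x`. -/
def region (f : M → E (n + 2)) (x : M) (hx : x ∉ lowerDecker f) : Region f :=
  ConnectedComponents.mk (⟨x, hx⟩ : {x : M // x ∉ lowerDecker f})

/-- The chamber that contains `y`. -/
def chamber (f : M → E (n + 2)) (y : E (n + 1)) (hy : y ∉ Set.range (shadowMap f)) : Chamber f :=
  ConnectedComponents.mk (⟨y, hy⟩ : {y : E (n + 1) // y ∉ Set.range (shadowMap f)})

/-- The open cone at `y` of the points that lie, by a margin `c`, behind the hyperplanes through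
`y` with normal vectors in `N` (that is, on the side from which the normals point). -/
def behind (N : Set (E (n + 1))) (y : E (n + 1)) (c : ℝ) : Set (E (n + 1)) :=
  {y' | ∀ v ∈ N, inner ℝ v (y' - y) < -c * ‖y' - y‖}

/-- Near `x` and on the sheet of `x`, the points of `M` behind the sheets with normal vectors in
`N` lie in regions of colour `q`. The margin makes the condition independent of the curvature
of the sheets. -/
def RegionColourBehind {X : Type*} (f : M → E (n + 2)) (φ : Region f → X) (x : M)
    (N : Set (E (n + 1))) (q : X) : Prop :=
  ∀ c : ℝ, 0 < c → ∀ᶠ x' in 𝓝 x, shadowMap f x' ∈ behind N (shadowMap f x) c →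
    ∃ h : x' ∉ lowerDecker f, φ (region f x' h) = q

/-- Near `y`, the points of `ℝ^{n+1}` behind the sheets with normal vectors in
`N` lie in chambers of colour `q`. -/
def ChamberColourBehind {X : Type*} (f : M → E (n + 2)) (ψ : Chamber f → X) (y : E (n + 1))
    (N : Set (E (n + 1))) (q : X) : Prop :=
  ∀ c : ℝ, 0 < c → ∀ᶠ y' in 𝓝 y, y' ∈ behind N y c →
    ∃ h : y' ∉ Set.range (shadowMap f), ψ (chamber f y' h) = q

/-! ### Colourings -/

/-- A colouring of the diagram of `f` by `X`. At a transverse double point with lower point `x`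
and upper point `u`, if `q₁` is the colour of the region of `M` at `x` from which the normal of
the upper sheet points, and `q₂` the colour of the region at `x` into which it points,
then `q₁ * φ(u) = q₂`. -/
structure Colouring (o : ManifoldOrientation n M) (f : M → E (n + 2)) (X : Type*) [Shelf X] where
  φ : Region f → X
  rule : ∀ (x u : M) (hu : u ∉ lowerDecker f), fibre f (shadowMap f u) = {x, u} →
    height (f x) < height (f u) → LinearIndependent ℝ ![normal o f x, normal o f u] →
    ∀ q₁ q₂ : X, RegionColourBehind f φ x {normal o f u} q₁ →
      RegionColourBehind f φ x {-normal o f u} q₂ → q₁ ⋆ φ (region f u hu) = q₂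

/-- A shadow colouring: a colouring of the regions, together with colours of the chambers such
that, at a regular point `x` of a sheet, the colours `q₁` and `q₂` of the chambers from which and
into which the normal of the sheet points satisfy `q₁ * φ(x) = q₂`. -/
structure ShadowColouring (o : ManifoldOrientation n M) (f : M → E (n + 2)) (X : Type*) [Shelf X]
    extends Colouring o f X where
  ψ : Chamber f → X
  shadow_rule : ∀ (x : M) (hx : x ∉ lowerDecker f), fibre f (shadowMap f x) = {x} →
    normal o f x ≠ 0 → ∀ q₁ q₂ : X, ChamberColourBehind f ψ (shadowMap f x) {normal o f x} q₁ →
      ChamberColourBehind f ψ (shadowMap f x) {-normal o f x} q₂ → q₁ ⋆ φ (region f x hx) = q₂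

/-! ### The chains of a coloured diagram -/

/-- The crossings of multiplicity `n + 1`. A crossing `p` is recorded by the list of the `n + 1`
points of `M` over `p`, ordered from the lowest to the highest; so each crossing occurs once. -/
def crossings (f : M → E (n + 2)) : Set (Fin (n + 1) → M) :=
  {x | StrictMono (fun i => height (f (x i))) ∧ Set.range x = fibre f (shadowMap f (x 0))}

/-- The sign of a crossing: the sign of the determinant of the normal vectors, listed
from the highest sheet to the lowest. -/
def crossingSign (o : ManifoldOrientation n M) (f : M → E (n + 2)) (x : Fin (n + 1) → M) : ℤ :=
  (SignType.sign (Matrix.det (Matrix.of (fun i j : Fin (n + 1) => normal o f (x i.rev) j))) :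
    SignType)

/-- `q i` is the colour of the `i`-th lowest sheet of the crossing `x` next to the source chamber,
which is the chamber at the crossing from which all normals point. -/
def IsCrossingColour {X : Type*} [Shelf X] {o : ManifoldOrientation n M} {f : M → E (n + 2)}
    (C : Colouring o f X) (x : Fin (n + 1) → M) (q : Fin (n + 1) → X) : Prop :=
  ∀ i, RegionColourBehind f C.φ (x i) {v | ∃ j, j ≠ i ∧ v = normal o f (x j)} (q i)

/-- `q₀` is the colour of the source chamber of the crossing `x`. -/
def IsSourceChamberColour {X : Type*} [Shelf X] {o : ManifoldOrientation n M} {f : M → E (n + 2)}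
    (C : ShadowColouring o f X) (x : Fin (n + 1) → M) (q₀ : X) : Prop :=
  ChamberColourBehind f C.ψ (shadowMap f (x 0)) (Set.range fun j => normal o f (x j)) q₀

open Classical in
/-- The contribution `c_{n+1}(p) = sgn(p) (q_1, …, q_{n+1})` of a crossing. (The colours exist and
are unique at the crossings of a regular projection in general position.) -/
def crossingChain {X : Type*} [Shelf X] {o : ManifoldOrientation n M} {f : M → E (n + 2)}
    (C : Colouring o f X) (x : Fin (n + 1) → M) : RackChain X (n + 1) :=
  if h : ∃ q : Fin (n + 1) → X, IsCrossingColour C x q then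
    crossingSign o f x • Finsupp.single h.choose (1 : ℤ) else 0

open Classical in
/-- The contribution `c_{n+2}(p) = sgn(p) (q_0, q_1, …, q_{n+1})` of a crossing. -/
def shadowCrossingChain {X : Type*} [Shelf X] {o : ManifoldOrientation n M} {f : M → E (n + 2)}
    (C : ShadowColouring o f X) (x : Fin (n + 1) → M) : RackChain X (n + 2) :=
  if h : ∃ q : Fin (n + 2) → X, IsSourceChamberColour C x (q 0) ∧
      IsCrossingColour C.toColouring x (Fin.tail q) then
    crossingSign o f x • Finsupp.single h.choose (1 : ℤ) else 0

/-- The chain `c_{n+1}(D_M, φ)`. -/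
def chain {X : Type*} [Shelf X] {o : ManifoldOrientation n M} {f : M → E (n + 2)}
    (C : Colouring o f X) : RackChain X (n + 1) :=
  ∑ᶠ x ∈ crossings f, crossingChain C x

/-- The shadow chain `c_{n+2}(D_M, φ̃)`. -/
def shadowChain {X : Type*} [Shelf X] {o : ManifoldOrientation n M} {f : M → E (n + 2)}
    (C : ShadowColouring o f X) : RackChain X (n + 2) :=
  ∑ᶠ x ∈ crossings f, shadowCrossingChain C x

/-! ### The pass move -/

/-- The pass move `S(c, n+2, 0)` from the diagram of `f` to the diagram of `f'`: a smooth isotopy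
`F`, with time `τ ∈ [-1, 1]`, that is supported over a compact part `K` of an open ball `U`
(an open set that is diffeomorphic to `ℝ^{n+1}`), and the track of which consists, over `U`, of
`n + 2` co-oriented sheets that form, in suitable coordinates at each time, the hyperplanes
`V_i = {(z, τ) | ⟪L i, z⟫ + τ * b i = 0}` of space-time `ℝ^{n+1} × ℝ`. These intersect
transversely in the single point `p = (0, 0)`, of multiplicity `n + 2`, and the
time direction is in general position to them. -/
structure PassMove (o : ManifoldOrientation n M) (f f' : M → E (n + 2)) where
  /-- The isotopy. -/
  F : ℝ → M → E (n + 2)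
  F_start : F (-1) = f
  F_end : F 1 = f'
  smooth : ContMDiffOn (𝓘(ℝ, ℝ).prod (𝓡 n)) 𝓘(ℝ, E (n + 2)) ∞ (fun p : ℝ × M => F p.1 p.2)
    (Set.Icc (-1) 1 ×ˢ Set.univ)
  knotting : ∀ τ ∈ Set.Icc (-1 : ℝ) 1, IsKnotting (F τ)
  /-- The ball in which the move takes place. -/
  U : Set (E (n + 1))
  isOpen_U : IsOpen U
  /-- The support of the move. -/
  K : Set (E (n + 1))
  isCompact_K : IsCompact K
  K_subset : K ⊆ U
  fixed : ∀ τ ∈ Set.Icc (-1 : ℝ) 1, ∀ x, shadowMap f x ∉ K → F τ x = f x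
  support : ∀ τ ∈ Set.Icc (-1 : ℝ) 1, ∀ x, shadowMap f x ∈ K → shadowMap (F τ) x ∈ K
  /-- The coordinates on the ball at time `τ`: orientation preserving diffeomorphisms
  `e τ : U → ℝ^{n+1}`, with inverse `inv τ`, that depend smoothly on `τ`. -/
  e : ℝ → E (n + 1) → E (n + 1)
  inv : ℝ → E (n + 1) → E (n + 1)
  inv_e : ∀ τ ∈ Set.Icc (-1 : ℝ) 1, ∀ y ∈ U, inv τ (e τ y) = y
  inv_mem : ∀ τ ∈ Set.Icc (-1 : ℝ) 1, ∀ z, inv τ z ∈ U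
  e_inv : ∀ τ ∈ Set.Icc (-1 : ℝ) 1, ∀ z, e τ (inv τ z) = z
  smooth_e : ContDiffOn ℝ ∞ (fun p : ℝ × E (n + 1) => e p.1 p.2) (Set.Icc (-1) 1 ×ˢ U)
  smooth_inv : ContDiffOn ℝ ∞ (fun p : ℝ × E (n + 1) => inv p.1 p.2)
    (Set.Icc (-1) 1 ×ˢ Set.univ)
  orientation_e : ∀ τ ∈ Set.Icc (-1 : ℝ) 1, ∀ y ∈ U, 0 < (fderiv ℝ (e τ) y).det
  /-- The space and time components of the normal vectors of the hyperplanes `V_i`. -/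
  L : Fin (n + 2) → E (n + 1)
  b : Fin (n + 2) → ℝ
  transverse : LinearIndependent ℝ (fun i => (L i, b i))
  time_generic : ∀ i, LinearIndependent ℝ (fun j : {j : Fin (n + 2) // j ≠ i} => L j)
  /-- The sheets, as parts of `M`. -/
  W : Fin (n + 2) → Set M
  isOpen_W : ∀ i, IsOpen (W i)
  disjoint_W : Pairwise fun i j => Disjoint (W i) (W j)
  cover_W : ∀ x, shadowMap f x ∈ U ↔ ∃ i, x ∈ W i
  sheets : ∀ τ ∈ Set.Icc (-1 : ℝ) 1, ∀ i,
    Set.BijOn (fun x => e τ (shadowMap (F τ) x)) (W i) {z | inner ℝ (L i) z + τ * b i = 0}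
  /-- The co-orientation of the `i`-th sheet is that of `V_i` (in particular, the sheets are
  immersed). -/
  coorientation : ∀ τ ∈ Set.Icc (-1 : ℝ) 1, ∀ i, ∀ x ∈ W i,
    0 < inner ℝ (L i) (fderiv ℝ (e τ) (shadowMap (F τ) x) (normal o (F τ) x))
  /-- The sheets are numbered from the lowest to the highest. -/
  order : ∀ τ ∈ Set.Icc (-1 : ℝ) 1, ∀ i j, i < j → ∀ x ∈ W i, ∀ u ∈ W j,
    shadowMap (F τ) x = shadowMap (F τ) u → height (F τ x) < height (F τ u)

variable {o : ManifoldOrientation n M} {f f' : M → E (n + 2)}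

/-- The position of `y`, at time `τ`, relative to the sheet `i`: negative on the side from which
the normal points. -/
def PassMove.side (R : PassMove o f f') (τ : ℝ) (i : Fin (n + 2)) (y : E (n + 1)) : ℝ :=
  inner ℝ (R.L i) (R.e τ y) + τ * R.b i

/-- `C'` is the colouring `R_#(C)` that corresponds to `C`: they coincide outside the
support of the move. -/
def PassMove.Corresponds {X : Type*} [Shelf X] (R : PassMove o f f') (C : Colouring o f X)
    (C' : Colouring o f' X) : Prop :=
  ∀ (x : M) (h : x ∉ lowerDecker f) (h' : x ∉ lowerDecker f'), shadowMap f x ∉ R.K →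
    C.φ (region f x h) = C'.φ (region f' x h')

/-- `C'` is the shadow colouring `R_#(C)` that corresponds to `C`: they coincide outside the
support of the move. -/
def PassMove.ShadowCorresponds {X : Type*} [Shelf X] (R : PassMove o f f')
    (C : ShadowColouring o f X) (C' : ShadowColouring o f' X) : Prop :=
  R.Corresponds C.toColouring C'.toColouring ∧
  ∀ (y : E (n + 1)) (h : y ∉ Set.range (shadowMap f)) (h' : y ∉ Set.range (shadowMap f')),
    y ∉ R.K → C.ψ (chamber f y h) = C'.ψ (chamber f' y h')

/-- `q = q(p) = (q_1, …, q_{n+2})`: for each `i`, the points of the `i`-th sheet, before and after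
the move, that lie on the source side of all other sheets have colour `q i`. (These
points are nonempty in at least one of the two diagrams.) -/
def PassMove.IsLabel {X : Type*} [Shelf X] (R : PassMove o f f') (C : Colouring o f X)
    (C' : Colouring o f' X) (q : Fin (n + 2) → X) : Prop :=
  ∀ i, ∀ x ∈ R.W i,
    ((∀ j, j ≠ i → R.side (-1) j (shadowMap f x) < 0) →
      ∃ h : x ∉ lowerDecker f, C.φ (region f x h) = q i) ∧
    ((∀ j, j ≠ i → R.side 1 j (shadowMap f' x) < 0) →
      ∃ h : x ∉ lowerDecker f', C'.φ (region f' x h) = q i)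

/-- `q = q_sh(p) = (q_0, q_1, …, q_{n+2})`: moreover, the points of `U`, before and after
the move, that lie on the source side of all sheets have colour `q_0`. -/
def PassMove.IsShadowLabel {X : Type*} [Shelf X] (R : PassMove o f f') (C : ShadowColouring o f X)
    (C' : ShadowColouring o f' X) (q : Fin (n + 3) → X) : Prop :=
  R.IsLabel C.toColouring C'.toColouring (Fin.tail q) ∧
  ∀ y ∈ R.U,
    ((∀ i, R.side (-1) i y < 0) →
      ∃ h : y ∉ Set.range (shadowMap f), C.ψ (chamber f y h) = q 0) ∧
    ((∀ i, R.side 1 i y < 0) →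
      ∃ h : y ∉ Set.range (shadowMap f'), C'.ψ (chamber f' y h) = q 0)

end Manifold

end PassMoveLemma

end

/-!
The sheets of the move are, in coordinates, hyperplanes `ℓ_k(z, τ) = ⟪L k, z⟫ + τ * b k = 0`. As
the normals `(L k, b k)` are independent, time is a combination `τ = ∑ λ_k ℓ_k` (`timeCoeff`), and
general position of the time direction means that no `λ_k` vanishes. At the crossing of all sheets
but the `i`-th we therefore have `ℓ_i = τ / λ_i`: it lies on the source side of the sheet `i` at
one of the times `τ = ±1`, and on the other side at the other one. By Cramer's rule its sign is, at
both times, `± (-1)^i sign λ_i` (`exists_sign_det_eq`, `IsCrossingOmitting.crossingSign_eq`).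

The colours at this crossing are the entries of `faceZero i q` if it lies on the source side of the
sheet `i`, and those of `faceStar i q` if it lies beyond (`HasColour.beyond`,
`IsCrossingOmitting.isCrossingColour_iff`); so the `n + 2` crossings in the ball contribute the
boundary of `q` to the difference of the chains (`sum_faces_eq`), and the crossings elsewhere
cancel (`finsum_crossings_sub`).

That the label `q` is well defined rests on three facts. The cells into which the other sheets cut
a sheet are convex in the coordinates, so each carries a single colour (`region_eq`). Each cell is
nonempty before or after the move (`exists_mem_cell`). If a cell is nonempty at both times, with
points `z` and `z'`, then `ℓ_k(z, -1) + ℓ_k(z', 1) = ⟪L k, z + z'⟫`, so that the cell contains a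
ray in the direction `z + z'`, which leaves the support of the move; since nothing changes outside
the support, the colours at the two times agree (`exists_notMem_support`, `Corresponds.colour_eq`).
The same arguments apply to the chambers.
-/

open scoped Manifold ContDiff Topology

noncomputable section

namespace PassMoveLemma

/-! ### Linear algebra of `m + 1` hyperplanes in general position in `ℝ^m × ℝ` -/

/-- The matrix of the normal vectors `(L k, b k)` of hyperplanes of `ℝ^m × ℝ`. -/
def spaceTimeMatrix {m : ℕ} (L : Fin (m + 1) → E m) (b : Fin (m + 1) → ℝ) :
    Matrix (Fin (m + 1)) (Fin (m + 1)) ℝ :=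
  Matrix.of fun k => Fin.snoc (α := fun _ => ℝ) (fun l => L k l) (b k)

theorem spaceTimeMatrix_castSucc {m : ℕ} (L : Fin (m + 1) → E m) (b : Fin (m + 1) → ℝ)
    (k : Fin (m + 1)) (l : Fin m) : spaceTimeMatrix L b k l.castSucc = L k l := by
  simp [spaceTimeMatrix]

theorem spaceTimeMatrix_last {m : ℕ} (L : Fin (m + 1) → E m) (b : Fin (m + 1) → ℝ)
    (k : Fin (m + 1)) : spaceTimeMatrix L b k (Fin.last m) = b k := by
  simp [spaceTimeMatrix]

theorem inner_eq_sum {m : ℕ} (v w : E m) : inner ℝ v w = ∑ l, v l * w l := by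
  simp [PiLp.inner_apply, mul_comm]

theorem spaceTimeMatrix_det_ne_zero {m : ℕ} {L : Fin (m + 1) → E m} {b : Fin (m + 1) → ℝ}
    (h : LinearIndependent ℝ (fun i => (L i, b i))) : (spaceTimeMatrix L b).det ≠ 0 := by
  intro hdet
  obtain ⟨v, hv, hvB⟩ := Matrix.exists_vecMul_eq_zero_iff.2 hdet
  refine hv (funext (Fintype.linearIndependent_iff.1 h v ?_))
  refine Prod.ext ?_ ?_
  · ext l
    have := congrFun hvB l.castSucc
    simp only [Matrix.vecMul, dotProduct, spaceTimeMatrix_castSucc, Pi.zero_apply] at this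
    simpa [Prod.fst_sum] using this
  · have := congrFun hvB (Fin.last m)
    simp only [Matrix.vecMul, dotProduct, spaceTimeMatrix_last, Pi.zero_apply] at this
    simpa [Prod.snd_sum] using this

/-- The coefficients that express the time coordinate by the `m + 1` linear forms
`(z, τ) ↦ ⟪L k, z⟫ + τ * b k`. -/
def timeCoeff {m : ℕ} (L : Fin (m + 1) → E m) (b : Fin (m + 1) → ℝ) (k : Fin (m + 1)) : ℝ :=
  (spaceTimeMatrix L b)⁻¹ (Fin.last m) k

section timeCoeff

variable {m : ℕ} {L : Fin (m + 1) → E m} {b : Fin (m + 1) → ℝ}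

theorem sum_timeCoeff_mul_b (h : LinearIndependent ℝ (fun i => (L i, b i))) :
    ∑ k, timeCoeff L b k * b k = 1 := by
  have := congrFun (congrFun (Matrix.nonsing_inv_mul (spaceTimeMatrix L b)
    (spaceTimeMatrix_det_ne_zero h).isUnit) (Fin.last m)) (Fin.last m)
  simpa [Matrix.mul_apply, timeCoeff, spaceTimeMatrix_last] using this

theorem sum_timeCoeff_smul (h : LinearIndependent ℝ (fun i => (L i, b i))) :
    ∑ k, timeCoeff L b k • L k = 0 := by
  ext l
  have := congrFun (congrFun (Matrix.nonsing_inv_mul (spaceTimeMatrix L b)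
    (spaceTimeMatrix_det_ne_zero h).isUnit) (Fin.last m)) l.castSucc
  rw [Matrix.mul_apply] at this
  simp only [spaceTimeMatrix_castSucc] at this
  rw [Matrix.one_apply_ne (Fin.castSucc_lt_last l).ne'] at this
  simpa [timeCoeff] using this

theorem sum_timeCoeff (h : LinearIndependent ℝ (fun i => (L i, b i))) (z : E m) (t : ℝ) :
    ∑ k, timeCoeff L b k * (inner ℝ (L k) z + t * b k) = t := by
  have h1 : ∑ k, timeCoeff L b k * inner ℝ (L k) z = 0 := by
    have := congrArg (fun v => inner ℝ v z) (sum_timeCoeff_smul h)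
    simpa [sum_inner, inner_smul_left] using this
  have h2 := sum_timeCoeff_mul_b h
  simp only [mul_add, Finset.sum_add_distrib, h1, zero_add]
  calc ∑ k, timeCoeff L b k * (t * b k) = t * ∑ k, timeCoeff L b k * b k := by
        rw [Finset.mul_sum]; exact Finset.sum_congr rfl fun _ _ => by ring
    _ = t := by rw [h2, mul_one]

/-- The linear forms `(z, τ) ↦ ⟪L k, z⟫ + τ * b k` take arbitrary values. -/
theorem exists_of_values (h : LinearIndependent ℝ (fun i => (L i, b i))) (s : Fin (m + 1) → ℝ) :
    ∃ z : E m, ∀ k, inner ℝ (L k) z + (∑ i, timeCoeff L b i * s i) * b k = s k := by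
  set y := (spaceTimeMatrix L b)⁻¹.mulVec s with hy
  refine ⟨WithLp.toLp 2 fun l => y l.castSucc, fun k => ?_⟩
  have h1 : (spaceTimeMatrix L b).mulVec y = s := by
    rw [hy, Matrix.mulVec_mulVec, Matrix.mul_nonsing_inv _ (spaceTimeMatrix_det_ne_zero h).isUnit,
      Matrix.one_mulVec]
  have h2 : y (Fin.last m) = ∑ i, timeCoeff L b i * s i := rfl
  have h3 := congrFun h1 k
  simp only [Matrix.mulVec, dotProduct, Fin.sum_univ_castSucc, spaceTimeMatrix_castSucc,
    spaceTimeMatrix_last] at h3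
  rw [inner_eq_sum, ← h2, ← h3, mul_comm (y (Fin.last m))]

theorem eq_of_inner_eq (h : LinearIndependent ℝ (fun i => (L i, b i))) {z z' : E m}
    (hz : ∀ k, inner ℝ (L k) z = inner ℝ (L k) z') : z = z' := by
  set y : Fin (m + 1) → ℝ := Fin.snoc (α := fun _ => ℝ) (fun l => (z - z') l) 0 with hy
  have h1 : (spaceTimeMatrix L b).mulVec y = 0 := by
    ext k
    have h2 : inner ℝ (L k) (z - z') = 0 := by rw [inner_sub_right, hz, sub_self]
    rw [inner_eq_sum] at h2
    simpa [Matrix.mulVec, dotProduct, Fin.sum_univ_castSucc, spaceTimeMatrix_castSucc, hy] using h2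
  have h3 := Matrix.eq_zero_of_mulVec_eq_zero (spaceTimeMatrix_det_ne_zero h) h1
  refine sub_eq_zero.1 ?_
  ext l
  have := congrFun h3 l.castSucc
  simpa [hy] using this

theorem timeCoeff_ne_zero (h : LinearIndependent ℝ (fun i => (L i, b i)))
    (hg : ∀ i, LinearIndependent ℝ (fun j : {j : Fin (m + 1) // j ≠ i} => L j))
    (i : Fin (m + 1)) : timeCoeff L b i ≠ 0 := by
  classical
  intro hi
  have h0 := sum_timeCoeff_smul h
  rw [← Finset.add_sum_erase _ _ (Finset.mem_univ i), hi, zero_smul, zero_add] at h0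
  have h1 : ∑ j : {j : Fin (m + 1) // j ≠ i}, timeCoeff L b j • L j = 0 := by
    rw [← h0]
    exact (Finset.sum_subtype _ (by simp) fun j => timeCoeff L b j • L j).symm
  have h2 := Fintype.linearIndependent_iff.1 (hg i) (fun j => timeCoeff L b j) h1
  have h3 : ∀ k, timeCoeff L b k = 0 := fun k => by
    by_cases hk : k = i
    · rw [hk, hi]
    · exact h2 ⟨k, hk⟩
  have := sum_timeCoeff_mul_b h
  simp [h3] at this

/-- By Cramer's rule, the coefficients are, up to alternating signs and a common factor, the
determinants of the families `L` with one vector omitted. -/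
theorem timeCoeff_eq_det (i : Fin (m + 1)) :
    timeCoeff L b i = (spaceTimeMatrix L b).det⁻¹ * ((-1) ^ ((i : ℕ) + m) *
      (Matrix.of fun (a l : Fin m) => L (i.succAbove a) l).det) := by
  rw [timeCoeff, Matrix.inv_def, Matrix.smul_apply, Matrix.adjugate_fin_succ_eq_det_submatrix,
    Ring.inverse_eq_inv', smul_eq_mul]
  congr 3
  ext a l
  simp [spaceTimeMatrix_castSucc]

/-- The signs of the determinants of `L`, with the `i`-th vector omitted and the others in
descending order, are `(-1)^i` times those of the coefficients, up to a common sign. -/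
theorem exists_sign_det_eq (h : LinearIndependent ℝ (fun i => (L i, b i))) :
    ∃ ε : ℤˣ, ∀ i : Fin (m + 1), ((SignType.sign (Matrix.of fun (a l : Fin m) =>
      L (i.succAbove a.rev) l).det : SignType) : ℤ) =
        (ε : ℤ) * (-1) ^ (i : ℕ) * (SignType.sign (timeCoeff L b i) : SignType) := by
  have hd := spaceTimeMatrix_det_ne_zero h
  set d := (spaceTimeMatrix L b).det with hdd
  have key : ∀ i : Fin (m + 1), (Matrix.of fun (a l : Fin m) => L (i.succAbove a.rev) l).det =
      (((Equiv.Perm.sign (Fin.revPerm : Equiv.Perm (Fin m)) : ℤˣ) : ℤ) : ℝ) * d * (-1) ^ m *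
        (-1) ^ (i : ℕ) * timeCoeff L b i := by
    intro i
    have h1 : (Matrix.of fun (a l : Fin m) => L (i.succAbove a.rev) l).det =
        (((Equiv.Perm.sign (Fin.revPerm : Equiv.Perm (Fin m)) : ℤˣ) : ℤ) : ℝ) *
          (Matrix.of fun (a l : Fin m) => L (i.succAbove a) l).det :=
      Matrix.det_permute Fin.revPerm (Matrix.of fun (a l : Fin m) => L (i.succAbove a) l)
    rw [h1, timeCoeff_eq_det, ← hdd]
    have h2 : ((-1 : ℝ) ^ (i : ℕ)) * (-1) ^ (i : ℕ) = 1 := by rw [← mul_pow]; simp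
    have h3 : ((-1 : ℝ) ^ m) * (-1) ^ m = 1 := by rw [← mul_pow]; simp
    rw [pow_add]
    field_simp
    linear_combination (-(Matrix.of fun (a l : Fin m) => L (i.succAbove a) l).det) *
      (h2 * (-1) ^ m * (-1) ^ m + h3)
  set c := (((Equiv.Perm.sign (Fin.revPerm : Equiv.Perm (Fin m)) : ℤˣ) : ℤ) : ℝ) * d * (-1) ^ m
    with hc
  have hc0 : c ≠ 0 := by
    rw [hc]
    refine mul_ne_zero (mul_ne_zero ?_ hd) (by simp)
    exact_mod_cast (Equiv.Perm.sign (Fin.revPerm : Equiv.Perm (Fin m))).ne_zero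
  have hs : ∀ i : ℕ, ((SignType.sign ((-1 : ℝ) ^ i) : SignType) : ℤ) = (-1) ^ i := fun i => by
    rcases Nat.even_or_odd i with hi | hi <;> simp [hi.neg_one_pow]
  rcases hc0.lt_or_gt with hlt | hgt
  · refine ⟨-1, fun i => ?_⟩
    rw [key, sign_mul, sign_mul, SignType.coe_mul, SignType.coe_mul, hs, sign_neg hlt]
    simp
  · refine ⟨1, fun i => ?_⟩
    rw [key, sign_mul, sign_mul, SignType.coe_mul, SignType.coe_mul, hs, sign_pos hgt]
    simp

end timeCoeff

/-- A determinant is, as a function of its last row, the inner product with the generalized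
cross product of the other rows. -/
theorem sum_mul_det_snoc {n : ℕ} (t : Fin n → E (n + 1)) (w : E (n + 1)) :
    ∑ k, w k * Matrix.det (Matrix.of (fun i l : Fin (n + 1) =>
      (Fin.snoc (α := fun _ => E (n + 1)) t (EuclideanSpace.single k (1 : ℝ)) i : E (n + 1)) l)) =
    Matrix.det (Matrix.of (fun i l : Fin (n + 1) =>
      (Fin.snoc (α := fun _ => E (n + 1)) t w i : E (n + 1)) l)) := by
  set B : Matrix (Fin (n + 1)) (Fin (n + 1)) ℝ := Matrix.of (fun i l : Fin (n + 1) =>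
      (Fin.snoc (α := fun _ => E (n + 1)) t w i : E (n + 1)) l)
  have h1 : ∀ v : E (n + 1), Matrix.of (fun i l : Fin (n + 1) =>
      (Fin.snoc (α := fun _ => E (n + 1)) t v i : E (n + 1)) l) =
      B.updateRow (Fin.last n) (fun l => v l) := by
    intro v
    ext i l
    refine Fin.lastCases ?_ (fun i => ?_) i
    · simp
    · simp [B]
  have h2 : (fun l => w l) =
      ∑ k, w k • (fun l => (EuclideanSpace.single k (1 : ℝ) : E (n + 1)) l) := by
    funext l
    simp [Finset.sum_apply]
  have h3 : B = B.updateRow (Fin.last n) (fun l => w l) := h1 w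
  rw [h3]
  simp only [h1]
  have h4 := (Matrix.detRowAlternating (R := ℝ) (n := Fin (n + 1))).toMultilinearMap.map_update_sum
    Finset.univ (Fin.last n)
    (fun k => w k • (fun l => (EuclideanSpace.single k (1 : ℝ) : E (n + 1)) l)) B
  rw [← h2] at h4
  refine Eq.trans ?_ h4.symm
  refine Finset.sum_congr rfl fun k _ => ?_
  exact (Matrix.det_updateRow_smul B (Fin.last n) (w k) _).symm

/-- A linear form that vanishes on `t₁, …, t_n` and does not vanish on their generalized cross
product `N` is a multiple of the inner product with `N`. -/
theorem eq_mul_inner_of_cross {n : ℕ} {t : Fin n → E (n + 1)} {N : E (n + 1)} {r : ℝ}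
    (hN : ∀ w : E (n + 1), inner ℝ N w = r * Matrix.det (Matrix.of (fun i l : Fin (n + 1) =>
      (Fin.snoc (α := fun _ => E (n + 1)) t w i : E (n + 1)) l)))
    (η : E (n + 1) →L[ℝ] ℝ) (hη : ∀ j, η (t j) = 0) (hpos : 0 < η N) :
    ∃ c : ℝ, 0 < c ∧ ∀ w, η w = c * inner ℝ N w := by
  have hN0 : N ≠ 0 := by rintro rfl; simp at hpos
  have hNN : 0 < inner ℝ N N := real_inner_self_pos.2 hN0
  have hdet : ∀ w : E (n + 1), inner ℝ N w ≠ 0 → LinearIndependent ℝ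
      (Fin.snoc (α := fun _ => E (n + 1)) t w) := by
    intro w hw
    rw [hN] at hw
    have h1 := Matrix.linearIndependent_rows_of_det_ne_zero (right_ne_zero_of_mul hw)
    exact LinearIndependent.of_comp (EuclideanSpace.equiv (Fin (n + 1)) ℝ).toLinearMap h1
  have hdet' : ∀ w : E (n + 1), inner ℝ N w = 0 → r ≠ 0 → ¬ LinearIndependent ℝ
      (Fin.snoc (α := fun _ => E (n + 1)) t w) := by
    intro w hw hr hli
    rw [hN] at hw
    have hz := (mul_eq_zero.1 hw).resolve_left hr
    have h2 := hli.map' (EuclideanSpace.equiv (Fin (n + 1)) ℝ).toLinearEquiv.toLinearMap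
      (LinearEquiv.ker _)
    exact (Matrix.linearIndependent_rows_iff_isUnit.1 h2 |>.map Matrix.detMonoidHom).ne_zero hz
  have hr : r ≠ 0 := by
    rintro rfl
    rw [hN] at hNN
    simp at hNN
  have htli : LinearIndependent ℝ t := (linearIndependent_finSnoc.1 (hdet N hNN.ne')).1
  refine ⟨η N / inner ℝ N N, div_pos hpos hNN, fun w => ?_⟩
  set w' := w - (inner ℝ N w / inner ℝ N N) • N with hw'
  have h1 : inner ℝ N w' = 0 := by
    rw [hw', inner_sub_right, inner_smul_right]
    field_simp
    ring
  have h2 : w' ∈ Submodule.span ℝ (Set.range t) := by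
    by_contra hmem
    exact hdet' w' h1 hr (linearIndependent_finSnoc.2 ⟨htli, hmem⟩)
  have h3 : η w' = 0 := by
    have : Submodule.span ℝ (Set.range t) ≤ LinearMap.ker (η : E (n + 1) →ₗ[ℝ] ℝ) := by
      rw [Submodule.span_le]
      rintro _ ⟨j, rfl⟩
      exact hη j
    exact this h2
  rw [hw', map_sub, map_smul, smul_eq_mul, sub_eq_zero] at h3
  rw [h3]
  ring

/-- A strictly increasing sequence of `m` elements of `Fin (m + 1)` omits exactly one element. -/
theorem exists_eq_succAbove {m : ℕ} {k : Fin m → Fin (m + 1)} (hk : StrictMono k) :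
    ∃ i : Fin (m + 1), k = i.succAbove := by
  have hns : ¬ Function.Surjective k := fun h => by
    have := Fintype.card_le_of_surjective k h
    simp at this
  rw [Function.Surjective] at hns
  push Not at hns
  obtain ⟨i, hi⟩ := hns
  refine ⟨i, (hk.range_inj (Fin.strictMono_succAbove i)).1 ?_⟩
  rw [Fin.range_succAbove]
  refine Set.eq_of_subset_of_ncard_le (by rintro _ ⟨a, rfl⟩; exact hi a) ?_
  have h1 : (Set.range k).ncard = m := by
    rw [← Set.image_univ, Set.ncard_image_of_injective _ hk.injective]; simp
  rw [h1, Set.ncard_compl]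
  simp

/-! ### The geometry of the sheets at a fixed time -/

theorem contDiff_proj {n : ℕ} : ContDiff ℝ ∞ (proj : E (n + 2) → E (n + 1)) := by
  refine contDiff_euclidean.2 fun i => ?_
  exact (EuclideanSpace.proj i.castSucc : E (n + 2) →L[ℝ] ℝ).contDiff

theorem connectedComponents_mk_eq {Y : Type*} [TopologicalSpace Y] {p : Y → Prop} {S : Set Y}
    (hS : IsPreconnected S) (hp : ∀ y ∈ S, p y) {x x' : Y} (hx : x ∈ S) (hx' : x' ∈ S) :
    ConnectedComponents.mk (⟨x, hp x hx⟩ : {y // p y}) =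
      ConnectedComponents.mk (⟨x', hp x' hx'⟩ : {y // p y}) := by
  have hind : Topology.IsInducing (Subtype.val : {y // p y} → Y) := ⟨rfl⟩
  have h0 : (Subtype.val : {y // p y} → Y) '' (Subtype.val ⁻¹' S) = S :=
    Set.image_preimage_eq_of_subset fun y hy => ⟨⟨y, hp y hy⟩, rfl⟩
  have h1 : IsPreconnected ((Subtype.val : {y // p y} → Y) ⁻¹' S) :=
    hind.isPreconnected_image.1 (by rwa [h0])
  have h2 : (⟨x, hp x hx⟩ : {y // p y}) ∈ connectedComponent ⟨x', hp x' hx'⟩ :=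
    h1.subset_connectedComponent (by exact hx') (by exact hx)
  exact ConnectedComponents.coe_eq_coe'.2 h2

theorem IsKnotting.contMDiff_shadowMap {n : ℕ} {M : Type*} [TopologicalSpace M]
    [ChartedSpace (E n) M] {g : M → E (n + 2)} (hg : IsKnotting g) :
    ContMDiff (𝓡 n) 𝓘(ℝ, E (n + 1)) ∞ (shadowMap g) :=
  contDiff_proj.contMDiff.comp (Manifold.IsSmoothEmbedding.contMDiff hg)

section Manifold

variable {n : ℕ} {M : Type*} [TopologicalSpace M] [ChartedSpace (E n) M] [IsManifold (𝓡 n) ∞ M]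
  {o : ManifoldOrientation n M} {f f' : M → E (n + 2)}

namespace PassMove

variable (R : PassMove o f f') {τ : ℝ}

theorem continuous_shadowMap (hτ : τ ∈ Set.Icc (-1 : ℝ) 1) : Continuous (shadowMap (R.F τ)) :=
  (R.knotting τ hτ).contMDiff_shadowMap.continuous

theorem F_eq_of_notMem (hτ : τ ∈ Set.Icc (-1 : ℝ) 1) {x : M} (h : shadowMap (R.F τ) x ∉ R.K) :
    shadowMap f x ∉ R.K ∧ R.F τ x = f x := by
  have h1 : shadowMap f x ∉ R.K := fun hx => h (R.support τ hτ x hx)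
  exact ⟨h1, R.fixed τ hτ x h1⟩

theorem shadowMap_eq_of_notMem (hτ : τ ∈ Set.Icc (-1 : ℝ) 1) {x : M} (h : shadowMap f x ∉ R.K) :
    shadowMap (R.F τ) x = shadowMap f x := by
  simp only [shadowMap, R.fixed τ hτ x h]

theorem mem_U_iff (hτ : τ ∈ Set.Icc (-1 : ℝ) 1) (x : M) :
    shadowMap (R.F τ) x ∈ R.U ↔ ∃ i, x ∈ R.W i := by
  rw [← R.cover_W]
  by_cases h : shadowMap f x ∈ R.K
  · exact iff_of_true (R.K_subset (R.support τ hτ x h)) (R.K_subset h)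
  · rw [R.shadowMap_eq_of_notMem hτ h]

theorem mem_U (hτ : τ ∈ Set.Icc (-1 : ℝ) 1) {i : Fin (n + 2)} {x : M} (hx : x ∈ R.W i) :
    shadowMap (R.F τ) x ∈ R.U := (R.mem_U_iff hτ x).2 ⟨i, hx⟩

theorem side_eq_zero (hτ : τ ∈ Set.Icc (-1 : ℝ) 1) {i : Fin (n + 2)} {x : M} (hx : x ∈ R.W i) :
    R.side τ i (shadowMap (R.F τ) x) = 0 := (R.sheets τ hτ i).mapsTo hx

theorem exists_mem_of_side_eq_zero (hτ : τ ∈ Set.Icc (-1 : ℝ) 1) {i : Fin (n + 2)} {y : E (n + 1)}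
    (hy : y ∈ R.U) (h : R.side τ i y = 0) : ∃ x ∈ R.W i, shadowMap (R.F τ) x = y := by
  obtain ⟨x, hx, hxy⟩ := (R.sheets τ hτ i).surjOn h
  refine ⟨x, hx, ?_⟩
  rw [← R.inv_e τ hτ _ hy, ← R.inv_e τ hτ _ (R.mem_U hτ hx)]
  exact congrArg _ hxy

theorem eq_of_shadowMap_eq (hτ : τ ∈ Set.Icc (-1 : ℝ) 1) {i : Fin (n + 2)} {x x' : M}
    (hx : x ∈ R.W i) (hx' : x' ∈ R.W i) (h : shadowMap (R.F τ) x = shadowMap (R.F τ) x') :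
    x = x' :=
  (R.sheets τ hτ i).injOn hx hx' (by simp only [h])

theorem eq_of_mem_W {i j : Fin (n + 2)} {x : M} (hi : x ∈ R.W i) (hj : x ∈ R.W j) : i = j := by
  by_contra h
  exact Set.disjoint_left.1 (R.disjoint_W h) hi hj

theorem side_inv (hτ : τ ∈ Set.Icc (-1 : ℝ) 1) (i : Fin (n + 2)) (z : E (n + 1)) :
    R.side τ i (R.inv τ z) = inner ℝ (R.L i) z + τ * R.b i := by
  rw [side, R.e_inv τ hτ]

theorem contDiffAt_e (hτ : τ ∈ Set.Icc (-1 : ℝ) 1) {y : E (n + 1)} (hy : y ∈ R.U) :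
    ContDiffAt ℝ ∞ (R.e τ) y := by
  have h : ContDiffOn ℝ ∞ (fun y => R.e τ y) R.U :=
    R.smooth_e.comp (f := fun y : E (n + 1) => (τ, y)) (by fun_prop) (fun y hy => ⟨hτ, hy⟩)
  exact h.contDiffAt (R.isOpen_U.mem_nhds hy)

theorem contDiff_inv (hτ : τ ∈ Set.Icc (-1 : ℝ) 1) : ContDiff ℝ ∞ (R.inv τ) := by
  have h : ContDiffOn ℝ ∞ (fun z => R.inv τ z) Set.univ :=
    R.smooth_inv.comp (f := fun y : E (n + 1) => (τ, y)) (by fun_prop)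
      (fun y _ => ⟨hτ, Set.mem_univ _⟩)
  exact contDiffOn_univ.1 h

theorem contDiffAt_side (hτ : τ ∈ Set.Icc (-1 : ℝ) 1) {y : E (n + 1)} (hy : y ∈ R.U)
    (i : Fin (n + 2)) : ContDiffAt ℝ ∞ (R.side τ i) y :=
  (contDiffAt_const.inner ℝ (R.contDiffAt_e hτ hy)).add contDiffAt_const

theorem continuousAt_side (hτ : τ ∈ Set.Icc (-1 : ℝ) 1) {y : E (n + 1)} (hy : y ∈ R.U)
    (i : Fin (n + 2)) : ContinuousAt (R.side τ i) y := (R.contDiffAt_side hτ hy i).continuousAt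

theorem continuousAt_side_shadowMap (hτ : τ ∈ Set.Icc (-1 : ℝ) 1) {x : M} {j : Fin (n + 2)}
    (hx : x ∈ R.W j) (i : Fin (n + 2)) :
    ContinuousAt (fun x => R.side τ i (shadowMap (R.F τ) x)) x :=
  ContinuousAt.comp (R.continuousAt_side hτ (R.mem_U hτ hx) i)
    (R.continuous_shadowMap hτ).continuousAt

/-- The parametrization `p` of the sheet `j` by the hyperplane `V_j`. It is continuous because the
projection of `M` is a closed map, `M` being compact, and the sheets are disjoint open sets. -/
theorem exists_lift [CompactSpace M] (hτ : τ ∈ Set.Icc (-1 : ℝ) 1) {j : Fin (n + 2)} {x₀ : M}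
    (hx₀ : x₀ ∈ R.W j) : ∃ p : E (n + 1) → M,
      (∀ z, inner ℝ (R.L j) z + τ * R.b j = 0 →
        p z ∈ R.W j ∧ shadowMap (R.F τ) (p z) = R.inv τ z) ∧
      (∀ x ∈ R.W j, p (R.e τ (shadowMap (R.F τ) x)) = x) ∧
      ContinuousOn p {z | inner ℝ (R.L j) z + τ * R.b j = 0} := by
  have : Nonempty M := ⟨x₀⟩
  have h1 : ∀ z, ∃ x : M, inner ℝ (R.L j) z + τ * R.b j = 0 →
      x ∈ R.W j ∧ shadowMap (R.F τ) x = R.inv τ z := by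
    intro z
    by_cases hz : inner ℝ (R.L j) z + τ * R.b j = 0
    · obtain ⟨x, hx, hxy⟩ := R.exists_mem_of_side_eq_zero hτ (R.inv_mem τ hτ z)
        ((R.side_inv hτ j z).trans hz)
      exact ⟨x, fun _ => ⟨hx, hxy⟩⟩
    · exact ⟨x₀, fun h => absurd h hz⟩
  choose p hp using h1
  refine ⟨p, hp, fun x hx => ?_, ?_⟩
  · have h2 := hp (R.e τ (shadowMap (R.F τ) x)) (R.side_eq_zero hτ hx)
    refine R.eq_of_shadowMap_eq hτ h2.1 hx ?_
    rw [h2.2, R.inv_e τ hτ _ (R.mem_U hτ hx)]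
  · intro z₀ hz₀
    rw [ContinuousWithinAt, Filter.tendsto_def]
    intro V hV
    -- Over `inv τ z₀`, there are only points of `V'` and of other sheets, hence also nearby.
    obtain ⟨V', hV'V, hV'o, hzV'⟩ := mem_nhds_iff.1 hV
    have hcl : IsClosed (V' ∪ ⋃ l, ⋃ (_ : l ≠ j), R.W l)ᶜ :=
      (hV'o.union (isOpen_iUnion fun l => isOpen_iUnion fun _ => R.isOpen_W l)).isClosed_compl
    have himg := (R.continuous_shadowMap hτ).isClosedMap _ hcl
    have hnot : R.inv τ z₀ ∈ (shadowMap (R.F τ) '' (V' ∪ ⋃ l, ⋃ (_ : l ≠ j), R.W l)ᶜ)ᶜ := by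
      rintro ⟨x, hx, hxz⟩
      apply hx
      obtain ⟨l, hl⟩ := (R.mem_U_iff hτ x).1 (hxz ▸ R.inv_mem τ hτ z₀)
      by_cases hlj : l = j
      · subst hlj
        left
        rw [R.eq_of_shadowMap_eq hτ hl (hp z₀ hz₀).1 (hxz.trans (hp z₀ hz₀).2.symm)]
        exact hzV'
      · right
        exact Set.mem_iUnion₂.2 ⟨l, hlj, hl⟩
    have hev := (R.contDiff_inv hτ).continuous.continuousAt (himg.isOpen_compl.mem_nhds hnot)
    filter_upwards [mem_nhdsWithin_of_mem_nhds hev, self_mem_nhdsWithin] with z hz hzj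
    by_contra hzV
    refine hz ⟨p z, ?_, (hp z hzj).2⟩
    rintro (h | h)
    · exact hzV (hV'V h)
    · obtain ⟨l, hlj, hl⟩ := Set.mem_iUnion₂.1 h
      exact hlj (R.eq_of_mem_W hl (hp z hzj).1)

/-- On the sheet `j`, the lower decker set lies in the intersections with higher sheets. -/
theorem notMem_lowerDecker (hτ : τ ∈ Set.Icc (-1 : ℝ) 1) {j : Fin (n + 2)} {x : M}
    (hx : x ∈ R.W j) (h : ∀ k, j < k → R.side τ k (shadowMap (R.F τ) x) ≠ 0) :
    x ∉ lowerDecker (R.F τ) := by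
  rw [lowerDecker, mem_closure_iff_nhds]
  push Not
  refine ⟨{x | x ∈ R.W j ∧ ∀ k, j < k → R.side τ k (shadowMap (R.F τ) x) ≠ 0}, ?_, ?_⟩
  · have h2 : ∀ᶠ x' in 𝓝 x, ∀ k, j < k → R.side τ k (shadowMap (R.F τ) x') ≠ 0 := by
      refine Filter.eventually_all.2 fun k => ?_
      by_cases hk : j < k
      · filter_upwards [(R.continuousAt_side_shadowMap hτ hx k).eventually_ne (h k hk)]
          with x' hx' _ using hx'
      · exact Filter.Eventually.of_forall fun _ h => absurd h hk
    filter_upwards [(R.isOpen_W j).mem_nhds hx, h2] with x' h3 h4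
    exact ⟨h3, h4⟩
  · rw [Set.eq_empty_iff_forall_notMem]
    rintro w ⟨⟨hw, hwk⟩, u, hu, hlt⟩
    obtain ⟨k, hk⟩ := (R.mem_U_iff hτ u).1 (hu ▸ R.mem_U hτ hw)
    rcases lt_trichotomy k j with hkj | rfl | hkj
    · exact lt_asymm hlt (R.order τ hτ k j hkj u hk w hw hu)
    · rw [R.eq_of_shadowMap_eq hτ hk hw hu] at hlt
      exact lt_irrefl _ hlt
    · exact hwk k hkj (hu ▸ R.side_eq_zero hτ hk)

theorem notMem_range (hτ : τ ∈ Set.Icc (-1 : ℝ) 1) {y : E (n + 1)} (hy : y ∈ R.U)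
    (h : ∀ k, R.side τ k y ≠ 0) : y ∉ Set.range (shadowMap (R.F τ)) := by
  rintro ⟨x, rfl⟩
  obtain ⟨k, hk⟩ := (R.mem_U_iff hτ x).1 hy
  exact h k (R.side_eq_zero hτ hk)

theorem affine_mul_pos {n : ℕ} {L z z' w : E n} {c : ℝ}
    (h : 0 < (inner ℝ L z + c) * (inner ℝ L z' + c))
    (hw : w ∈ segment ℝ z z') : 0 < (inner ℝ L z + c) * (inner ℝ L w + c) := by
  obtain ⟨s, t, hs, ht, hst, rfl⟩ := hw
  have h1 : inner ℝ L (s • z + t • z') + c =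
      s * (inner ℝ L z + c) + t * (inner ℝ L z' + c) := by
    rw [inner_add_right, inner_smul_right, inner_smul_right]
    linear_combination -c * hst
  rw [h1]
  have h2 : inner ℝ L z + c ≠ 0 := left_ne_zero_of_mul h.ne'
  have h3 : 0 < (inner ℝ L z + c) * (inner ℝ L z + c) := mul_self_pos.2 h2
  rcases hs.eq_or_lt with rfl | hs
  · simp only [zero_add] at hst
    subst hst
    simpa using h
  · nlinarith [mul_pos hs h3, mul_nonneg ht h.le]

/-- Two points of the sheet `j` that lie on the same sides of all higher sheets lie in the same
region: in the coordinates on `U`, the segment between them avoids the lower decker set. -/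
theorem region_eq [CompactSpace M] (hτ : τ ∈ Set.Icc (-1 : ℝ) 1) {j : Fin (n + 2)} {x x' : M}
    (hx : x ∈ R.W j) (hx' : x' ∈ R.W j)
    (h : ∀ k, j < k → 0 < R.side τ k (shadowMap (R.F τ) x) * R.side τ k (shadowMap (R.F τ) x')) :
    ∃ (h₁ : x ∉ lowerDecker (R.F τ)) (h₂ : x' ∉ lowerDecker (R.F τ)),
      region (R.F τ) x h₁ = region (R.F τ) x' h₂ := by
  obtain ⟨p, hp, hpe, hpc⟩ := R.exists_lift hτ hx
  set z := R.e τ (shadowMap (R.F τ) x) with hz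
  set z' := R.e τ (shadowMap (R.F τ) x') with hz'
  have hz0 : inner ℝ (R.L j) z + τ * R.b j = 0 := R.side_eq_zero hτ hx
  have hz0' : inner ℝ (R.L j) z' + τ * R.b j = 0 := R.side_eq_zero hτ hx'
  have hseg : segment ℝ z z' ⊆ {z | inner ℝ (R.L j) z + τ * R.b j = 0} := by
    rintro _ ⟨s, t, hs, ht, hst, rfl⟩
    simp only [Set.mem_ofPred_eq]
    rw [inner_add_right, inner_smul_right, inner_smul_right]
    linear_combination s * hz0 + t * hz0' - τ * R.b j * hst
  have hpre : IsPreconnected (p '' segment ℝ z z') :=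
    (convex_segment z z').isPreconnected.image p (hpc.mono hseg)
  have hav : ∀ w ∈ p '' segment ℝ z z', w ∉ lowerDecker (R.F τ) := by
    rintro _ ⟨w, hw, rfl⟩
    refine R.notMem_lowerDecker hτ (hp w (hseg hw)).1 fun k hk => ?_
    rw [(hp w (hseg hw)).2, R.side_inv hτ]
    exact right_ne_zero_of_mul (affine_mul_pos (h k hk) hw).ne'
  have hm : x ∈ p '' segment ℝ z z' := ⟨z, left_mem_segment ℝ z z', hpe x hx⟩
  have hm' : x' ∈ p '' segment ℝ z z' := ⟨z', right_mem_segment ℝ z z', hpe x' hx'⟩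
  exact ⟨hav x hm, hav x' hm', connectedComponents_mk_eq hpre hav hm hm'⟩

/-- Two points of `U` that lie on the same sides of all sheets lie in the same chamber. -/
theorem chamber_eq (hτ : τ ∈ Set.Icc (-1 : ℝ) 1) {y y' : E (n + 1)}
    (hy : y ∈ R.U) (hy' : y' ∈ R.U) (h : ∀ k, 0 < R.side τ k y * R.side τ k y') :
    ∃ (h₁ : y ∉ Set.range (shadowMap (R.F τ))) (h₂ : y' ∉ Set.range (shadowMap (R.F τ))),
      chamber (R.F τ) y h₁ = chamber (R.F τ) y' h₂ := by
  have hpre : IsPreconnected (R.inv τ '' segment ℝ (R.e τ y) (R.e τ y')) :=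
    (convex_segment _ _).isPreconnected.image _ (R.contDiff_inv hτ).continuous.continuousOn
  have hav : ∀ w ∈ R.inv τ '' segment ℝ (R.e τ y) (R.e τ y'),
      w ∉ Set.range (shadowMap (R.F τ)) := by
    rintro _ ⟨w, hw, rfl⟩
    refine R.notMem_range hτ (R.inv_mem τ hτ w) fun k => ?_
    rw [R.side_inv hτ]
    exact right_ne_zero_of_mul (affine_mul_pos (h k) hw).ne'
  have hm : y ∈ R.inv τ '' segment ℝ (R.e τ y) (R.e τ y') :=
    ⟨_, left_mem_segment ℝ _ _, R.inv_e τ hτ y hy⟩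
  have hm' : y' ∈ R.inv τ '' segment ℝ (R.e τ y) (R.e τ y') :=
    ⟨_, right_mem_segment ℝ _ _, R.inv_e τ hτ y' hy'⟩
  exact ⟨hav y hm, hav y' hm', connectedComponents_mk_eq hpre hav hm hm'⟩

/-- The oriented normal of the sheet `i` represents, up to a positive factor, the derivative of
the function `side τ i`. -/
theorem exists_fderiv_side_eq (hτ : τ ∈ Set.Icc (-1 : ℝ) 1) {i : Fin (n + 2)} {x : M}
    (hx : x ∈ R.W i) : ∃ c : ℝ, 0 < c ∧ ∀ w : E (n + 1),
      inner ℝ (R.L i) (fderiv ℝ (R.e τ) (shadowMap (R.F τ) x) w) =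
        c * inner ℝ (normal o (R.F τ) x) w := by
  set y := shadowMap (R.F τ) x with hy
  have hyU : y ∈ R.U := R.mem_U hτ hx
  have hed : DifferentiableAt ℝ (R.e τ) y := (R.contDiffAt_e hτ hyU).differentiableAt (by simp)
  set η : E (n + 1) →L[ℝ] ℝ := (innerSL ℝ (R.L i)).comp (fderiv ℝ (R.e τ) y) with hη
  have hηw : ∀ w, η w = inner ℝ (R.L i) (fderiv ℝ (R.e τ) y w) := fun w => rfl
  have hker : ∀ v : TangentSpace (𝓡 n) x,
      η (mfderiv (𝓡 n) 𝓘(ℝ, E (n + 1)) (shadowMap (R.F τ)) x v) = 0 := by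
    intro v
    have h1 : HasMFDerivAt (𝓡 n) 𝓘(ℝ, E (n + 1)) (shadowMap (R.F τ)) x
        (mfderiv (𝓡 n) 𝓘(ℝ, E (n + 1)) (shadowMap (R.F τ)) x) :=
      ((R.knotting τ hτ).contMDiff_shadowMap.mdifferentiable (by simp) x).hasMFDerivAt
    have h2 : HasFDerivAt (R.side τ i) η y := by
      have h3 := ((innerSL ℝ (R.L i)).hasFDerivAt.comp y hed.hasFDerivAt).add_const (τ * R.b i)
      exact h3
    have h4 := HasMFDerivAt.comp x h2.hasMFDerivAt h1
    -- The sheet `i` is mapped to the zero set of `side τ i`.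
    have h5 : HasMFDerivAt (𝓡 n) 𝓘(ℝ, ℝ) (R.side τ i ∘ shadowMap (R.F τ)) x 0 := by
      refine (hasMFDerivAt_const (0 : ℝ) x).congr_of_eventuallyEq ?_
      filter_upwards [(R.isOpen_W i).mem_nhds hx] with x' hx'
      exact R.side_eq_zero hτ hx'
    have h6 := hasMFDerivAt_unique h4 h5
    exact congrArg (fun (l : TangentSpace (𝓡 n) x →L[ℝ] ℝ) => l v) h6
  refine eq_mul_inner_of_cross (t := tangentVec (R.F τ) x) (r := (((o.sign x : ℤˣ) : ℤ) : ℝ))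
    (fun w => ?_) η (fun j => hker _) (R.coorientation τ hτ i x hx)
  rw [← sum_mul_det_snoc, inner_eq_sum, Finset.mul_sum]
  refine Finset.sum_congr rfl fun k _ => ?_
  simp only [normal]
  ring

end PassMove

end Manifold

/-! ### Colours behind the sheets through a point -/

section Manifold

variable {n : ℕ} {M : Type*} [TopologicalSpace M] [ChartedSpace (E n) M] [IsManifold (𝓡 n) ∞ M]
  {o : ManifoldOrientation n M} {f f' : M → E (n + 2)}

namespace PassMove

variable (R : PassMove o f f') {τ : ℝ}

/-- The first order expansion of `side τ k` at a point of the sheet `k`, by the normal. -/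
theorem eventually_abs_side_sub_le (hτ : τ ∈ Set.Icc (-1 : ℝ) 1) {k : Fin (n + 2)} {x : M}
    (hx : x ∈ R.W k) {c : ℝ} (hc : 0 < c) : ∃ d : ℝ, 0 < d ∧
      ∀ᶠ y in 𝓝 (shadowMap (R.F τ) x),
        |R.side τ k y - d * inner ℝ (normal o (R.F τ) x) (y - shadowMap (R.F τ) x)| ≤
          d * c * ‖y - shadowMap (R.F τ) x‖ := by
  obtain ⟨d, hd, hdw⟩ := R.exists_fderiv_side_eq hτ hx
  refine ⟨d, hd, ?_⟩
  have hyU := R.mem_U hτ hx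
  have hed : DifferentiableAt ℝ (R.e τ) (shadowMap (R.F τ) x) :=
    (R.contDiffAt_e hτ hyU).differentiableAt (by simp)
  have h2 : HasFDerivAt (R.side τ k) ((innerSL ℝ (R.L k)).comp
      (fderiv ℝ (R.e τ) (shadowMap (R.F τ) x))) (shadowMap (R.F τ) x) :=
    ((innerSL ℝ (R.L k)).hasFDerivAt.comp _ hed.hasFDerivAt).add_const (τ * R.b k)
  have h3 := (hasFDerivAt_iff_isLittleO.1 h2).bound (mul_pos hd hc)
  filter_upwards [h3] with y hy
  rw [R.side_eq_zero hτ hx, sub_zero] at hy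
  rw [← hdw]
  exact hy

theorem eventually_side_neg (hτ : τ ∈ Set.Icc (-1 : ℝ) 1) {k : Fin (n + 2)} {x : M}
    (hx : x ∈ R.W k) {c : ℝ} (hc : 0 < c) : ∀ᶠ y in 𝓝 (shadowMap (R.F τ) x),
      inner ℝ (normal o (R.F τ) x) (y - shadowMap (R.F τ) x) < -c * ‖y - shadowMap (R.F τ) x‖ →
        R.side τ k y < 0 := by
  obtain ⟨d, hd, h⟩ := R.eventually_abs_side_sub_le hτ hx hc
  filter_upwards [h] with y hy hlt
  nlinarith [(abs_le.1 hy).2, mul_lt_mul_of_pos_left hlt hd]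

theorem eventually_side_pos (hτ : τ ∈ Set.Icc (-1 : ℝ) 1) {k : Fin (n + 2)} {x : M}
    (hx : x ∈ R.W k) {c : ℝ} (hc : 0 < c) : ∀ᶠ y in 𝓝 (shadowMap (R.F τ) x),
      inner ℝ (-normal o (R.F τ) x) (y - shadowMap (R.F τ) x) < -c * ‖y - shadowMap (R.F τ) x‖ →
        0 < R.side τ k y := by
  obtain ⟨d, hd, h⟩ := R.eventually_abs_side_sub_le hτ hx hc
  filter_upwards [h] with y hy hlt
  rw [inner_neg_left] at hlt
  nlinarith [(abs_le.1 hy).1, mul_lt_mul_of_pos_left hlt hd]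

/-- The derivative of the parametrization `inv τ` of `U` takes the sides of the hyperplanes to
those of the tangent spaces of the sheets. -/
theorem exists_inner_eq (hτ : τ ∈ Set.Icc (-1 : ℝ) 1) {k : Fin (n + 2)} {x : M}
    (hx : x ∈ R.W k) {y : E (n + 1)} (hxy : shadowMap (R.F τ) x = y) :
    ∃ c : ℝ, 0 < c ∧ ∀ v : E (n + 1), inner ℝ (R.L k) v =
      c * inner ℝ (normal o (R.F τ) x) (fderiv ℝ (R.inv τ) (R.e τ y) v) := by
  subst hxy
  obtain ⟨c, hc, h⟩ := R.exists_fderiv_side_eq hτ hx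
  refine ⟨c, hc, fun v => ?_⟩
  rw [← h]
  set y := shadowMap (R.F τ) x with hy
  have hyU : y ∈ R.U := R.mem_U hτ hx
  have hed : DifferentiableAt ℝ (R.e τ) y := (R.contDiffAt_e hτ hyU).differentiableAt (by simp)
  have hid : DifferentiableAt ℝ (R.inv τ) (R.e τ y) :=
    ((R.contDiff_inv hτ).contDiffAt).differentiableAt (by simp)
  have h1 : HasFDerivAt (R.e τ ∘ R.inv τ)
      ((fderiv ℝ (R.e τ) y).comp (fderiv ℝ (R.inv τ) (R.e τ y))) (R.e τ y) := by
    refine HasFDerivAt.comp _ ?_ hid.hasFDerivAt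
    rw [R.inv_e τ hτ y hyU]
    exact hed.hasFDerivAt
  have h2 : R.e τ ∘ R.inv τ = id := funext fun z => R.e_inv τ hτ z
  rw [h2] at h1
  have h3 := h1.unique (hasFDerivAt_id _)
  have h4 : fderiv ℝ (R.e τ) y (fderiv ℝ (R.inv τ) (R.e τ y) v) = v :=
    congrArg (fun (l : E (n + 1) →L[ℝ] E (n + 1)) => l v) h3
  rw [h4]

/-- If `v` points, in the coordinates at time `τ`, to the negative side of the vectors in `N`, then
the ray from `y` in the direction `v` starts behind them, with a positive margin. -/
theorem eventually_mem_behind (hτ : τ ∈ Set.Icc (-1 : ℝ) 1) {y : E (n + 1)} (hy : y ∈ R.U)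
    {v : E (n + 1)} {N : Set (E (n + 1))} (hN : N.Finite)
    (h : ∀ u ∈ N, inner ℝ u (fderiv ℝ (R.inv τ) (R.e τ y) v) < 0) :
    ∃ c : ℝ, 0 < c ∧ ∀ᶠ t in 𝓝[>] (0 : ℝ), R.inv τ (R.e τ y + t • v) ∈ behind N y c := by
  set w := fderiv ℝ (R.inv τ) (R.e τ y) v with hw
  have h1 : ∀ᶠ c in 𝓝[>] (0 : ℝ), ∀ u ∈ N, inner ℝ u w < -c * ‖w‖ := by
    refine (Filter.eventually_all_finite hN).2 fun u hu => ?_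
    have h2 : Filter.Tendsto (fun c : ℝ => -c * ‖w‖) (𝓝[>] 0) (𝓝 0) := by
      have : Continuous fun c : ℝ => -c * ‖w‖ := by fun_prop
      simpa using (this.tendsto 0).mono_left nhdsWithin_le_nhds
    exact h2.eventually_const_lt (h u hu)
  obtain ⟨c, hcN, hc⟩ := (h1.and self_mem_nhdsWithin).exists
  have hc : 0 < c := hc
  refine ⟨c, hc, ?_⟩
  have hid : DifferentiableAt ℝ (R.inv τ) (R.e τ y) :=
    ((R.contDiff_inv hτ).contDiffAt).differentiableAt (by simp)
  have h3 : HasDerivAt (fun t : ℝ => R.inv τ (R.e τ y + t • v)) w 0 :=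
    hid.hasFDerivAt.hasLineDerivAt v
  have h4 : Filter.Tendsto (fun t : ℝ => t⁻¹ • (R.inv τ (R.e τ y + t • v) - y)) (𝓝[>] 0) (𝓝 w) := by
    have := h3.tendsto_slope_zero_right
    simpa [R.inv_e τ hτ y hy] using this
  have h5 : ∀ᶠ t in 𝓝[>] (0 : ℝ), ∀ u ∈ N,
      inner ℝ u (t⁻¹ • (R.inv τ (R.e τ y + t • v) - y)) <
        -c * ‖t⁻¹ • (R.inv τ (R.e τ y + t • v) - y)‖ := by
    refine (Filter.eventually_all_finite hN).2 fun u hu => ?_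
    have h6 : ∀ᶠ w' in 𝓝 w, inner ℝ u w' < -c * ‖w'‖ := by
      have h7 : IsOpen {w' : E (n + 1) | inner ℝ u w' < -c * ‖w'‖} :=
        isOpen_lt (by fun_prop) (by fun_prop)
      exact h7.mem_nhds (hcN u hu)
    exact h4.eventually h6
  filter_upwards [h5, self_mem_nhdsWithin] with t ht htpos u hu
  have htpos : 0 < t := htpos
  have h8 := ht u hu
  rw [inner_smul_right, norm_smul, norm_inv, Real.norm_eq_abs, abs_of_pos htpos] at h8
  have h9 := mul_lt_mul_of_pos_left h8 htpos
  have h10 : t * t⁻¹ = 1 := mul_inv_cancel₀ htpos.ne'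
  calc inner ℝ u (R.inv τ (R.e τ y + t • v) - y)
      = t * (t⁻¹ * inner ℝ u (R.inv τ (R.e τ y + t • v) - y)) := by rw [← mul_assoc, h10, one_mul]
    _ < t * (-c * (t⁻¹ * ‖R.inv τ (R.e τ y + t • v) - y‖)) := h9
    _ = -c * ‖R.inv τ (R.e τ y + t • v) - y‖ * (t * t⁻¹) := by ring
    _ = _ := by rw [h10, mul_one]

theorem tendsto_inv_ray (hτ : τ ∈ Set.Icc (-1 : ℝ) 1) {y : E (n + 1)} (hy : y ∈ R.U)
    (v : E (n + 1)) :
    Filter.Tendsto (fun t : ℝ => R.inv τ (R.e τ y + t • v)) (𝓝[>] 0) (𝓝 y) := by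
  have h1 : Continuous fun t : ℝ => R.inv τ (R.e τ y + t • v) :=
    (R.contDiff_inv hτ).continuous.comp (by fun_prop)
  have h2 := h1.tendsto 0
  simp only [zero_smul, add_zero, R.inv_e τ hτ y hy] at h2
  exact h2.mono_left nhdsWithin_le_nhds

/-- The colour behind the sheets with normals in `N` is unique if there is a direction along the
sheet that leads behind them all. -/
theorem regionColourBehind_unique [CompactSpace M] (hτ : τ ∈ Set.Icc (-1 : ℝ) 1) {X : Type*}
    {φ : Region (R.F τ) → X} {j : Fin (n + 2)} {x : M} (hx : x ∈ R.W j) {N : Set (E (n + 1))}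
    (hN : N.Finite) {v : E (n + 1)} (hv : inner ℝ (R.L j) v = 0)
    (h : ∀ u ∈ N, inner ℝ u (fderiv ℝ (R.inv τ) (R.e τ (shadowMap (R.F τ) x)) v) < 0) {q q' : X}
    (hq : RegionColourBehind (R.F τ) φ x N q) (hq' : RegionColourBehind (R.F τ) φ x N q') :
    q = q' := by
  obtain ⟨c, hc, hb⟩ := R.eventually_mem_behind hτ (R.mem_U hτ hx) hN h
  obtain ⟨p, hp, hpe, hpc⟩ := R.exists_lift hτ hx
  set z := R.e τ (shadowMap (R.F τ) x) with hz
  have hz0 : inner ℝ (R.L j) z + τ * R.b j = 0 := R.side_eq_zero hτ hx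
  have hline : ∀ t : ℝ, inner ℝ (R.L j) (z + t • v) + τ * R.b j = 0 := fun t => by
    rw [inner_add_right, inner_smul_right, hv, mul_zero, add_zero, hz0]
  have ht : Filter.Tendsto (fun t : ℝ => p (z + t • v)) (𝓝[>] 0) (𝓝 x) := by
    have h1 : Continuous fun t : ℝ => p (z + t • v) :=
      hpc.comp_continuous (by fun_prop) hline
    have h2 := h1.tendsto 0
    simp only [zero_smul, add_zero, hz, hpe x hx] at h2
    exact h2.mono_left nhdsWithin_le_nhds
  obtain ⟨t, hbt, h1, h2⟩ := (hb.and (ht.eventually ((hq c hc).and (hq' c hc)))).exists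
  rw [← (hp _ (hline t)).2] at hbt
  obtain ⟨_, e1⟩ := h1 hbt
  obtain ⟨_, e2⟩ := h2 hbt
  exact e1.symm.trans e2

theorem chamberColourBehind_unique (hτ : τ ∈ Set.Icc (-1 : ℝ) 1) {X : Type*}
    {ψ : Chamber (R.F τ) → X} {y : E (n + 1)} (hy : y ∈ R.U) {N : Set (E (n + 1))}
    (hN : N.Finite) {v : E (n + 1)}
    (h : ∀ u ∈ N, inner ℝ u (fderiv ℝ (R.inv τ) (R.e τ y) v) < 0) {q q' : X}
    (hq : ChamberColourBehind (R.F τ) ψ y N q) (hq' : ChamberColourBehind (R.F τ) ψ y N q') :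
    q = q' := by
  obtain ⟨c, hc, hb⟩ := R.eventually_mem_behind hτ hy hN h
  obtain ⟨t, hbt, h1, h2⟩ :=
    (hb.and ((R.tendsto_inv_ray hτ hy v).eventually ((hq c hc).and (hq' c hc)))).exists
  obtain ⟨_, e1⟩ := h1 hbt
  obtain ⟨_, e2⟩ := h2 hbt
  exact e1.symm.trans e2

/-- The points of the sheet `j` of the diagram of `g`, at time `τ`, that lie on the sides of the
other sheets given by the signs of `σ`, have colour `q`. -/
def CellColour {X : Type*} (R : PassMove o f f') (τ : ℝ) {g : M → E (n + 2)} (φ : Region g → X)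
    (j : Fin (n + 2)) (σ : Fin (n + 2) → ℝ) (q : X) : Prop :=
  ∀ x ∈ R.W j, (∀ k, k ≠ j → 0 < σ k * R.side τ k (shadowMap g x)) →
    ∃ h : x ∉ lowerDecker g, φ (region g x h) = q

/-- The points of `U`, at time `τ`, that lie on the sides of the sheets given by the signs of `σ`,
lie in chambers of colour `q`. -/
def ChamberCellColour {X : Type*} (R : PassMove o f f') (τ : ℝ) {g : M → E (n + 2)}
    (ψ : Chamber g → X) (σ : Fin (n + 2) → ℝ) (q : X) : Prop :=
  ∀ y ∈ R.U, (∀ k, 0 < σ k * R.side τ k y) →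
    ∃ h : y ∉ Set.range (shadowMap g), ψ (chamber g y h) = q

/-- Near a point `y` over `U`, the points behind sheets through `y` lie in the cell given by `σ`
if `N` contains the suitably directed normals of all sheets through `y` that bound it. -/
theorem eventually_mem_cell (hτ : τ ∈ Set.Icc (-1 : ℝ) 1) {y : E (n + 1)} (hy : y ∈ R.U)
    {N : Set (E (n + 1))} {σ : Fin (n + 2) → ℝ} {k : Fin (n + 2)}
    (h : 0 < σ k * R.side τ k y ∨ ∃ u ∈ R.W k, shadowMap (R.F τ) u = y ∧
      (σ k < 0 ∧ normal o (R.F τ) u ∈ N ∨ 0 < σ k ∧ -normal o (R.F τ) u ∈ N))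
    {c : ℝ} (hc : 0 < c) : ∀ᶠ y' in 𝓝 y, y' ∈ behind N y c → 0 < σ k * R.side τ k y' := by
  rcases h with h | ⟨u, hu, rfl, ⟨hs, hN⟩ | ⟨hs, hN⟩⟩
  · have h1 : ContinuousAt (fun y => σ k * R.side τ k y) y :=
      continuousAt_const.mul (R.continuousAt_side hτ hy k)
    filter_upwards [h1.eventually_const_lt h] with y' hy' _ using hy'
  · filter_upwards [R.eventually_side_neg hτ hu hc] with y' hy' hb
    exact mul_pos_of_neg_of_neg hs (hy' (hb _ hN))
  · filter_upwards [R.eventually_side_pos hτ hu hc] with y' hy' hb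
    exact mul_pos hs (hy' (hb _ hN))

variable {R} in
theorem CellColour.regionColourBehind (hτ : τ ∈ Set.Icc (-1 : ℝ) 1) {X : Type*}
    {φ : Region (R.F τ) → X} {j : Fin (n + 2)} {σ : Fin (n + 2) → ℝ} {q : X}
    (hcell : R.CellColour τ φ j σ q) {x : M} (hx : x ∈ R.W j) {N : Set (E (n + 1))}
    (h : ∀ k, k ≠ j → 0 < σ k * R.side τ k (shadowMap (R.F τ) x) ∨
      ∃ u ∈ R.W k, shadowMap (R.F τ) u = shadowMap (R.F τ) x ∧
        (σ k < 0 ∧ normal o (R.F τ) u ∈ N ∨ 0 < σ k ∧ -normal o (R.F τ) u ∈ N)) :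
    RegionColourBehind (R.F τ) φ x N q := by
  intro c hc
  have h1 : ∀ᶠ y in 𝓝 (shadowMap (R.F τ) x), ∀ k, k ≠ j →
      y ∈ behind N (shadowMap (R.F τ) x) c → 0 < σ k * R.side τ k y := by
    refine Filter.eventually_all.2 fun k => ?_
    by_cases hk : k = j
    · exact Filter.Eventually.of_forall fun _ h => absurd hk h
    · filter_upwards [R.eventually_mem_cell hτ (R.mem_U hτ hx) (h k hk) hc] with y hy _ using hy
  filter_upwards [(R.isOpen_W j).mem_nhds hx,
    (R.continuous_shadowMap hτ).continuousAt.eventually h1] with x' hx' hk hb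
  exact hcell x' hx' fun k hkj => hk k hkj hb

variable {R} in
theorem ChamberCellColour.chamberColourBehind (hτ : τ ∈ Set.Icc (-1 : ℝ) 1) {X : Type*}
    {ψ : Chamber (R.F τ) → X} {σ : Fin (n + 2) → ℝ} {q : X}
    (hcell : R.ChamberCellColour τ ψ σ q) {y : E (n + 1)} (hy : y ∈ R.U) {N : Set (E (n + 1))}
    (h : ∀ k, 0 < σ k * R.side τ k y ∨
      ∃ u ∈ R.W k, shadowMap (R.F τ) u = y ∧
        (σ k < 0 ∧ normal o (R.F τ) u ∈ N ∨ 0 < σ k ∧ -normal o (R.F τ) u ∈ N)) :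
    ChamberColourBehind (R.F τ) ψ y N q := by
  intro c hc
  have h1 : ∀ᶠ y' in 𝓝 y, ∀ k, y' ∈ behind N y c → 0 < σ k * R.side τ k y' :=
    Filter.eventually_all.2 fun k => R.eventually_mem_cell hτ hy (h k) hc
  filter_upwards [R.isOpen_U.mem_nhds hy, h1] with y' hy' hk hb
  exact hcell y' hy' fun k => hk k hb

/-! ### Linear forms on the ball -/

/-- Any `n + 1` of the vectors `L k` have arbitrary inner products with a suitable vector. -/
theorem exists_direction (i : Fin (n + 2)) (s : Fin (n + 2) → ℝ) :
    ∃ v : E (n + 1), ∀ k, k ≠ i → inner ℝ (R.L k) v = s k := by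
  classical
  have hi := timeCoeff_ne_zero R.transverse R.time_generic i
  set S := ∑ k ∈ Finset.univ.erase i, timeCoeff R.L R.b k * s k with hS
  obtain ⟨v, hv⟩ := exists_of_values R.transverse
    (Function.update s i (-(S / timeCoeff R.L R.b i)))
  have h0 : ∑ k, timeCoeff R.L R.b k * Function.update s i (-(S / timeCoeff R.L R.b i)) k = 0 := by
    rw [← Finset.add_sum_erase _ _ (Finset.mem_univ i), Function.update_self]
    have h1 : ∑ k ∈ Finset.univ.erase i, timeCoeff R.L R.b k *
        Function.update s i (-(S / timeCoeff R.L R.b i)) k = S :=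
      Finset.sum_congr rfl fun k hk => by rw [Function.update_of_ne (Finset.ne_of_mem_erase hk)]
    rw [h1]
    field_simp
    ring
  refine ⟨v, fun k hk => ?_⟩
  have := hv k
  rwa [h0, zero_mul, add_zero, Function.update_of_ne hk] at this

/-- Every combination of signs, other than all zero, is realized before or after the move. -/
theorem exists_mem_cell {σ : Fin (n + 2) → ℝ} {k₀ : Fin (n + 2)} (hk₀ : σ k₀ ≠ 0) :
    ∃ τ : ℝ, (τ = -1 ∨ τ = 1) ∧ ∃ y ∈ R.U,
      ∀ k, (σ k = 0 → R.side τ k y = 0) ∧ (σ k ≠ 0 → 0 < σ k * R.side τ k y) := by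
  classical
  obtain ⟨s, hs, hsum⟩ : ∃ s : Fin (n + 2) → ℝ,
      (∀ k, (σ k = 0 → s k = 0) ∧ (σ k ≠ 0 → 0 < σ k * s k)) ∧
        ∑ k, timeCoeff R.L R.b k * s k ≠ 0 := by
    by_cases h : ∑ k, timeCoeff R.L R.b k * σ k = 0
    -- If `σ` is realized at time zero, doubling one nonzero entry changes the time.
    · refine ⟨fun k => σ k + if k = k₀ then σ k₀ else 0, fun k => ?_, ?_⟩
      · by_cases hk : k = k₀
        · subst hk
          refine ⟨fun h => absurd h hk₀, fun h => ?_⟩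
          simp only [if_true]
          nlinarith [mul_self_pos.2 h]
        · simp only [hk, if_false, add_zero]
          exact ⟨id, fun h => mul_self_pos.2 h⟩
      · simp only [mul_add, Finset.sum_add_distrib, h, zero_add]
        simpa using ⟨timeCoeff_ne_zero R.transverse R.time_generic k₀, hk₀⟩
    · exact ⟨σ, fun k => ⟨id, fun h => mul_self_pos.2 h⟩, h⟩
  -- The sheets are homogeneous in space-time, so rescaling yields a point at time `±1`.
  set T := ∑ k, timeCoeff R.L R.b k * s k with hT
  have hTpos : 0 < |T| := abs_pos.2 hsum
  obtain ⟨z, hz⟩ := exists_of_values R.transverse (fun k => s k / |T|)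
  have hsum' : ∑ k, timeCoeff R.L R.b k * (s k / |T|) = T / |T| := by
    rw [hT, Finset.sum_div]
    exact Finset.sum_congr rfl fun k _ => by ring
  have hτ' : T / |T| = -1 ∨ T / |T| = 1 := by
    rcases hsum.lt_or_gt with h | h
    · left; rw [abs_of_neg h, div_neg, div_self hsum]
    · right; rw [abs_of_pos h, div_self hsum]
  have hτ : T / |T| ∈ Set.Icc (-1 : ℝ) 1 := by rcases hτ' with h | h <;> rw [h] <;> norm_num
  refine ⟨T / |T|, hτ', R.inv _ z, R.inv_mem _ hτ z, fun k => ?_⟩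
  rw [R.side_inv hτ, ← hsum', hz]
  refine ⟨fun h => by rw [(hs k).1 h, zero_div], fun h => ?_⟩
  rw [← mul_div_assoc]
  exact div_pos ((hs k).2 h) hTpos

/-- Moving off the sheet `i` along the sheet `j`, without crossing other sheets. -/
theorem exists_adjacent (hτ : τ ∈ Set.Icc (-1 : ℝ) 1) {y : E (n + 1)} (hy : y ∈ R.U)
    (i j l : Fin (n + 2)) (hil : i ≠ l) (hjl : j ≠ l) (hij : i ≠ j)
    (hi : R.side τ i y = 0) (hj : R.side τ j y = 0) {ε : ℝ} (hε : ε ≠ 0) :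
    ∃ y' ∈ R.U, R.side τ j y' = 0 ∧ 0 < ε * R.side τ i y' ∧
      ∀ k, R.side τ k y ≠ 0 → 0 < R.side τ k y * R.side τ k y' := by
  obtain ⟨v, hv⟩ := R.exists_direction l (fun k => if k = i then ε else 0)
  have h1 : ∀ k, ∀ t : ℝ, R.side τ k (R.inv τ (R.e τ y + t • v)) =
      R.side τ k y + t * inner ℝ (R.L k) v := fun k t => by
    rw [R.side_inv hτ, side, inner_add_right, inner_smul_right]; ring
  have h2 : ∀ᶠ t in 𝓝[>] (0 : ℝ), ∀ k, R.side τ k y ≠ 0 →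
      0 < R.side τ k y * R.side τ k (R.inv τ (R.e τ y + t • v)) := by
    refine Filter.eventually_all.2 fun k => ?_
    by_cases hk : R.side τ k y = 0
    · exact Filter.Eventually.of_forall fun _ h => absurd hk h
    · have h3 : ContinuousAt (fun y' => R.side τ k y * R.side τ k y') y :=
        continuousAt_const.mul (R.continuousAt_side hτ hy k)
      have h4 := (R.tendsto_inv_ray hτ hy v).eventually
        (h3.eventually_const_lt (mul_self_pos.2 hk))
      filter_upwards [h4] with t ht _ using ht
  obtain ⟨t, ht, htpos⟩ := (h2.and self_mem_nhdsWithin).exists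
  have htpos : 0 < t := htpos
  refine ⟨_, R.inv_mem τ hτ _, ?_, ?_, ht⟩
  · rw [h1, hj, hv j hjl, if_neg hij.symm]; ring
  · rw [h1, hi, hv i hil, if_pos rfl]
    nlinarith [mul_pos htpos (mul_self_pos.2 hε)]

end PassMove

end Manifold

/-! ### Colours before and after the move -/

theorem mul_pos_of_common_sign {s a b : ℝ} (ha : 0 < s * a) (hb : 0 < s * b) : 0 < a * b := by
  rcases (mul_pos_iff.1 ha) with ⟨h1, h2⟩ | ⟨h1, h2⟩
  · exact mul_pos h2 ((mul_pos_iff_of_pos_left h1).1 hb)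
  · exact mul_pos_of_neg_of_neg h2 ((neg_iff_neg_of_mul_pos hb).1 h1)

theorem exists_ne_ne {n : ℕ} (hn : 1 ≤ n) (i j : Fin (n + 2)) : ∃ l, i ≠ l ∧ j ≠ l := by
  classical
  by_contra h
  push Not at h
  have h1 : (Finset.univ : Finset (Fin (n + 2))) ⊆ {i, j} := fun l _ => by
    by_cases hi : i = l
    · simp [hi]
    · simp [h l hi]
  have h2 := (Finset.card_le_card h1).trans Finset.card_le_two
  simp at h2
  omega

section Manifold

variable {n : ℕ} {M : Type*} [TopologicalSpace M] [ChartedSpace (E n) M] [IsManifold (𝓡 n) ∞ M]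
  {o : ManifoldOrientation n M} {f f' : M → E (n + 2)}

namespace PassMove

variable (R : PassMove o f f') {τ : ℝ}

theorem neg_one_mem : (-1 : ℝ) ∈ Set.Icc (-1 : ℝ) 1 := by norm_num

theorem one_mem : (1 : ℝ) ∈ Set.Icc (-1 : ℝ) 1 := by norm_num

/-- Outside the support, the sheets do not move, so a point cannot change sides. -/
theorem side_mul_side_pos {y : E (n + 1)} (hy : y ∈ R.U) (hyK : y ∉ R.K) {k : Fin (n + 2)}
    (h : R.side (-1) k y ≠ 0) : 0 < R.side (-1) k y * R.side 1 k y := by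
  have hc : ContinuousOn (fun t : ℝ => R.side t k y) (Set.Icc (-1) 1) := by
    have h1 : ContinuousOn (fun t : ℝ => R.e t y) (Set.Icc (-1) 1) :=
      R.smooth_e.continuousOn.comp (f := fun t : ℝ => (t, y)) (by fun_prop) fun t ht => ⟨ht, hy⟩
    have h2 : ContinuousOn (fun t : ℝ => inner ℝ (R.L k) (R.e t y)) (Set.Icc (-1) 1) :=
      (innerSL ℝ (R.L k)).continuous.comp_continuousOn h1
    exact h2.add (continuousOn_id.mul continuousOn_const)
  by_contra hle
  have h0 : (0 : ℝ) ∈ Set.uIcc (R.side (-1) k y) (R.side 1 k y) := by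
    rw [Set.mem_uIcc]
    rcases h.lt_or_gt with h | h
    · exact Or.inl ⟨h.le, not_lt.1 fun h' => hle (mul_pos_of_neg_of_neg h h')⟩
    · exact Or.inr ⟨not_lt.1 fun h' => hle (mul_pos h h'), h.le⟩
  have hle' : (-1 : ℝ) ≤ 1 := by norm_num
  rw [← Set.uIcc_of_le hle'] at hc
  obtain ⟨t, ht, ht0⟩ := intermediate_value_uIcc (f := fun t : ℝ => R.side t k y) hc h0
  rw [Set.uIcc_of_le hle'] at ht
  obtain ⟨x, hx, hxy⟩ := R.exists_mem_of_side_eq_zero ht hy ht0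
  have h2 := R.F_eq_of_notMem ht (hxy ▸ hyK)
  have h3 := R.side_eq_zero neg_one_mem hx
  rw [R.shadowMap_eq_of_notMem neg_one_mem h2.1, ← R.shadowMap_eq_of_notMem ht h2.1, hxy] at h3
  exact h h3

/-- If two points `y`, before the move, and `y'`, after the move, lie in corresponding cells, the
cell is invariant under translation by the sum of their coordinates. So it is unbounded, and leaves
the support. -/
theorem exists_notMem_support {y y' : E (n + 1)}
    (h : ∀ k, R.side (-1) k y = 0 ∧ R.side 1 k y' = 0 ∨ 0 < R.side (-1) k y * R.side 1 k y')
    {k₀ : Fin (n + 2)} (hk₀ : R.side (-1) k₀ y ≠ 0) :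
    ∃ w ∈ R.U, w ∉ R.K ∧ ∀ k, (R.side (-1) k y = 0 → R.side (-1) k w = 0) ∧
      (R.side (-1) k y ≠ 0 → 0 < R.side (-1) k y * R.side (-1) k w) := by
  set v := R.e (-1) y + R.e 1 y' with hv
  have hLv : ∀ k, inner ℝ (R.L k) v = R.side (-1) k y + R.side 1 k y' := fun k => by
    rw [hv, inner_add_right, side, side]; ring
  have hv0 : v ≠ 0 := by
    intro h0
    have h1 := hLv k₀
    rw [h0, inner_zero_right] at h1
    rcases h k₀ with h2 | h2
    · exact hk₀ h2.1
    · rw [eq_neg_of_add_eq_zero_right h1.symm] at h2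
      nlinarith [mul_self_nonneg (R.side (-1) k₀ y)]
  have hKc : IsCompact (R.e (-1) '' R.K) :=
    R.isCompact_K.image_of_continuousOn fun w hw =>
      (R.contDiffAt_e neg_one_mem (R.K_subset hw)).continuousAt.continuousWithinAt
  obtain ⟨r, hr⟩ := hKc.isBounded.exists_norm_le
  obtain ⟨t, ht, htr⟩ : ∃ t : ℝ, 0 ≤ t ∧ r < ‖R.e (-1) y + t • v‖ := by
    have hvpos : 0 < ‖v‖ := norm_pos_iff.2 hv0
    refine ⟨(|r| + ‖R.e (-1) y‖ + 1) / ‖v‖, by positivity, ?_⟩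
    have h2 : ‖((|r| + ‖R.e (-1) y‖ + 1) / ‖v‖) • v‖ = |r| + ‖R.e (-1) y‖ + 1 := by
      rw [norm_smul, Real.norm_of_nonneg (by positivity)]
      field_simp
    have h3 := norm_sub_le (R.e (-1) y + ((|r| + ‖R.e (-1) y‖ + 1) / ‖v‖) • v) (R.e (-1) y)
    rw [add_sub_cancel_left, h2] at h3
    linarith [le_abs_self r]
  have hside : ∀ k, R.side (-1) k (R.inv (-1) (R.e (-1) y + t • v)) =
      R.side (-1) k y + t * (R.side (-1) k y + R.side 1 k y') := fun k => by
    rw [R.side_inv neg_one_mem, inner_add_right, inner_smul_right, hLv]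
    simp only [side]
    ring
  refine ⟨_, R.inv_mem _ neg_one_mem (R.e (-1) y + t • v), fun hK => ?_, fun k => ?_⟩
  · have := hr _ (Set.mem_image_of_mem _ hK)
    rw [R.e_inv _ neg_one_mem] at this
    exact absurd this (not_le.2 htr)
  · rw [hside]
    refine ⟨fun h0 => ?_, fun hne => ?_⟩
    · rcases h k with h2 | h2
      · rw [h2.1, h2.2]; ring
      · rw [h0, zero_mul] at h2; exact absurd h2 (lt_irrefl _)
    · have h2 := (h k).resolve_left fun h2 => hne h2.1
      nlinarith [mul_self_pos.2 hne, mul_nonneg ht (mul_self_pos.2 hne).le, mul_nonneg ht h2.le]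

theorem region_eq_of_eq [CompactSpace M] (hτ : τ ∈ Set.Icc (-1 : ℝ) 1) {g : M → E (n + 2)}
    (hg : R.F τ = g) {j : Fin (n + 2)} {x x' : M} (hx : x ∈ R.W j) (hx' : x' ∈ R.W j)
    (h : ∀ k, j < k → 0 < R.side τ k (shadowMap g x) * R.side τ k (shadowMap g x')) :
    ∃ (h₁ : x ∉ lowerDecker g) (h₂ : x' ∉ lowerDecker g), region g x h₁ = region g x' h₂ := by
  subst hg
  exact R.region_eq hτ hx hx' h

theorem chamber_eq_of_eq (hτ : τ ∈ Set.Icc (-1 : ℝ) 1) {g : M → E (n + 2)}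
    (hg : R.F τ = g) {y y' : E (n + 1)} (hy : y ∈ R.U) (hy' : y' ∈ R.U)
    (h : ∀ k, 0 < R.side τ k y * R.side τ k y') :
    ∃ (h₁ : y ∉ Set.range (shadowMap g)) (h₂ : y' ∉ Set.range (shadowMap g)),
      chamber g y h₁ = chamber g y' h₂ := by
  subst hg
  exact R.chamber_eq hτ hy hy' h

variable {X : Type*}

theorem side_eq_zero_start {i : Fin (n + 2)} {x : M} (hx : x ∈ R.W i) :
    R.side (-1) i (shadowMap f x) = 0 := by
  have h := R.side_eq_zero neg_one_mem hx
  rwa [R.F_start] at h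

theorem side_eq_zero_end {i : Fin (n + 2)} {x : M} (hx : x ∈ R.W i) :
    R.side 1 i (shadowMap f' x) = 0 := by
  have h := R.side_eq_zero one_mem hx
  rwa [R.F_end] at h

/-- Corresponding cells of a sheet have the same colour before and after the move. -/
theorem Corresponds.colour_eq [CompactSpace M] [Shelf X] (hn : 1 ≤ n) {C : Colouring o f X}
    {C' : Colouring o f' X} (hC : R.Corresponds C C') {j : Fin (n + 2)} {x x' : M}
    (hx : x ∈ R.W j) (hx' : x' ∈ R.W j) (h : ∀ k, k ≠ j →
      0 < R.side (-1) k (shadowMap f x) * R.side 1 k (shadowMap f' x')) :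
    ∃ (h₁ : x ∉ lowerDecker f) (h₂ : x' ∉ lowerDecker f'),
      C.φ (region f x h₁) = C'.φ (region f' x' h₂) := by
  have hxU : shadowMap f x ∈ R.U := (R.cover_W x).2 ⟨j, hx⟩
  obtain ⟨l, hjl, -⟩ := exists_ne_ne hn j j
  obtain ⟨w, hwU, hwK, hw⟩ := R.exists_notMem_support (y' := shadowMap f' x') (fun k => by
    by_cases hk : k = j
    · subst hk
      exact Or.inl ⟨R.side_eq_zero_start hx, R.side_eq_zero_end hx'⟩
    · exact Or.inr (h k hk)) (left_ne_zero_of_mul (h l hjl.symm).ne')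
  obtain ⟨u, hu, huw⟩ := R.exists_mem_of_side_eq_zero neg_one_mem hwU
    ((hw j).1 (R.side_eq_zero_start hx))
  rw [R.F_start] at huw
  subst huw
  have huw' : shadowMap f' u = shadowMap f u := by
    rw [← R.shadowMap_eq_of_notMem one_mem hwK, R.F_end]
  have h1 : ∀ k, k ≠ j → 0 < R.side (-1) k (shadowMap f x) * R.side (-1) k (shadowMap f u) :=
    fun k hk => (hw k).2 (left_ne_zero_of_mul (h k hk).ne')
  obtain ⟨a1, a2, a3⟩ := R.region_eq_of_eq neg_one_mem R.F_start hx hu fun k hk => h1 k hk.ne'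
  obtain ⟨b1, b2, b3⟩ := R.region_eq_of_eq one_mem R.F_end hx' hu fun k hk => by
    rw [huw']
    have h2 := R.side_mul_side_pos hwU hwK (right_ne_zero_of_mul (h1 k hk.ne').ne')
    refine mul_pos_of_common_sign (h k hk.ne') ?_
    refine mul_pos_of_common_sign ?_ h2
    rw [mul_comm]
    exact h1 k hk.ne'
  exact ⟨a1, b1, by rw [a3, b3, hC u a2 b2 hwK]⟩

/-- Corresponding cells of `U` have the same colour before and after the move. -/
theorem chamberColour_eq {ψ : Chamber f → X} {ψ' : Chamber f' → X}
    (hC : ∀ (y : E (n + 1)) (h : y ∉ Set.range (shadowMap f)) (h' : y ∉ Set.range (shadowMap f')),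
      y ∉ R.K → ψ (chamber f y h) = ψ' (chamber f' y h')) {y y' : E (n + 1)}
    (hy : y ∈ R.U) (hy' : y' ∈ R.U) (h : ∀ k, 0 < R.side (-1) k y * R.side 1 k y') :
    ∃ (h₁ : y ∉ Set.range (shadowMap f)) (h₂ : y' ∉ Set.range (shadowMap f')),
      ψ (chamber f y h₁) = ψ' (chamber f' y' h₂) := by
  obtain ⟨w, hwU, hwK, hw⟩ := R.exists_notMem_support (fun k => Or.inr (h k))
    (left_ne_zero_of_mul (h 0).ne')
  have h1 : ∀ k, 0 < R.side (-1) k y * R.side (-1) k w :=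
    fun k => (hw k).2 (left_ne_zero_of_mul (h k).ne')
  obtain ⟨a1, a2, a3⟩ := R.chamber_eq_of_eq neg_one_mem R.F_start hy hwU h1
  obtain ⟨b1, b2, b3⟩ := R.chamber_eq_of_eq one_mem R.F_end hy' hwU fun k => by
    have h2 := R.side_mul_side_pos hwU hwK (right_ne_zero_of_mul (h1 k).ne')
    refine mul_pos_of_common_sign (h k) ?_
    refine mul_pos_of_common_sign ?_ h2
    rw [mul_comm]
    exact h1 k
  exact ⟨a1, b1, by rw [a3, b3, hC w a2 b2 hwK]⟩

/-- The cell of the sheet `j` given by the signs of `σ` has the colour `q` before and after the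
move. -/
def HasColour [Shelf X] (R : PassMove o f f') (C : Colouring o f X) (C' : Colouring o f' X)
    (j : Fin (n + 2)) (σ : Fin (n + 2) → ℝ) (q : X) : Prop :=
  R.CellColour (-1) C.φ j σ q ∧ R.CellColour 1 C'.φ j σ q

/-- The cell of `U` given by the signs of `σ` has the colour `q` before and after the move. -/
def HasChamberColour (R : PassMove o f f') (ψ : Chamber f → X) (ψ' : Chamber f' → X)
    (σ : Fin (n + 2) → ℝ) (q : X) : Prop :=
  R.ChamberCellColour (-1) ψ σ q ∧ R.ChamberCellColour 1 ψ' σ q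

/-- A colour exists and is unique because each cell is nonempty at one of the times `±1`. -/
theorem existsUnique_hasColour [CompactSpace M] [Shelf X] (hn : 1 ≤ n) {C : Colouring o f X}
    {C' : Colouring o f' X} (hC : R.Corresponds C C') (j : Fin (n + 2)) {σ : Fin (n + 2) → ℝ}
    (hσ : ∀ k, k ≠ j → σ k ≠ 0) : ∃! q, R.HasColour C C' j σ q := by
  classical
  obtain ⟨l, hjl, -⟩ := exists_ne_ne hn j j
  obtain ⟨τ, hτ, y, hy, hcell⟩ := R.exists_mem_cell (σ := Function.update σ j 0) (k₀ := l)
    (by rw [Function.update_of_ne hjl.symm]; exact hσ l hjl.symm)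
  have hyj : R.side τ j y = 0 := (hcell j).1 (by simp)
  have hyk : ∀ k, k ≠ j → 0 < σ k * R.side τ k y := fun k hk => by
    have := (hcell k).2
    rw [Function.update_of_ne hk] at this
    exact this (hσ k hk)
  rcases hτ with rfl | rfl
  · obtain ⟨x, hx, hxy⟩ := R.exists_mem_of_side_eq_zero neg_one_mem hy hyj
    rw [R.F_start] at hxy
    subst hxy
    obtain ⟨h1, -, -⟩ := R.region_eq_of_eq neg_one_mem R.F_start hx hx fun k hk =>
      mul_pos_of_common_sign (hyk k hk.ne') (hyk k hk.ne')
    refine ⟨C.φ (region f x h1), ⟨fun x' hx' hk => ?_, fun x' hx' hk => ?_⟩, fun q hq => ?_⟩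
    · obtain ⟨a1, a2, a3⟩ := R.region_eq_of_eq neg_one_mem R.F_start hx hx' fun k hkj =>
        mul_pos_of_common_sign (hyk k hkj.ne') (hk k hkj.ne')
      exact ⟨a2, by rw [← a3]⟩
    · obtain ⟨a1, a2, a3⟩ := hC.colour_eq R hn hx hx' fun k hkj =>
        mul_pos_of_common_sign (hyk k hkj) (hk k hkj)
      exact ⟨a2, a3.symm⟩
    · obtain ⟨_, h⟩ := hq.1 x hx hyk
      exact h.symm
  · obtain ⟨x, hx, hxy⟩ := R.exists_mem_of_side_eq_zero one_mem hy hyj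
    rw [R.F_end] at hxy
    subst hxy
    obtain ⟨h1, -, -⟩ := R.region_eq_of_eq one_mem R.F_end hx hx fun k hk =>
      mul_pos_of_common_sign (hyk k hk.ne') (hyk k hk.ne')
    refine ⟨C'.φ (region f' x h1), ⟨fun x' hx' hk => ?_, fun x' hx' hk => ?_⟩, fun q hq => ?_⟩
    · obtain ⟨a1, a2, a3⟩ := hC.colour_eq R hn hx' hx fun k hkj =>
        mul_pos_of_common_sign (hk k hkj) (hyk k hkj)
      exact ⟨a1, a3⟩
    · obtain ⟨a1, a2, a3⟩ := R.region_eq_of_eq one_mem R.F_end hx hx' fun k hkj =>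
        mul_pos_of_common_sign (hyk k hkj.ne') (hk k hkj.ne')
      exact ⟨a2, by rw [← a3]⟩
    · obtain ⟨_, h⟩ := hq.2 x hx hyk
      exact h.symm

theorem existsUnique_hasChamberColour {ψ : Chamber f → X} {ψ' : Chamber f' → X}
    (hC : ∀ (y : E (n + 1)) (h : y ∉ Set.range (shadowMap f)) (h' : y ∉ Set.range (shadowMap f')),
      y ∉ R.K → ψ (chamber f y h) = ψ' (chamber f' y h')) {σ : Fin (n + 2) → ℝ}
    (hσ : ∀ k, σ k ≠ 0) : ∃! q, R.HasChamberColour ψ ψ' σ q := by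
  obtain ⟨τ, hτ, y, hy, hcell⟩ := R.exists_mem_cell (σ := σ) (k₀ := 0) (hσ 0)
  have hyk : ∀ k, 0 < σ k * R.side τ k y := fun k => (hcell k).2 (hσ k)
  rcases hτ with rfl | rfl
  · obtain ⟨h1, -, -⟩ := R.chamber_eq_of_eq neg_one_mem R.F_start hy hy fun k =>
      mul_pos_of_common_sign (hyk k) (hyk k)
    refine ⟨ψ (chamber f y h1), ⟨fun y' hy' hk => ?_, fun y' hy' hk => ?_⟩, fun q hq => ?_⟩
    · obtain ⟨a1, a2, a3⟩ := R.chamber_eq_of_eq neg_one_mem R.F_start hy hy' fun k =>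
        mul_pos_of_common_sign (hyk k) (hk k)
      exact ⟨a2, by rw [← a3]⟩
    · obtain ⟨a1, a2, a3⟩ := R.chamberColour_eq hC hy hy' fun k =>
        mul_pos_of_common_sign (hyk k) (hk k)
      exact ⟨a2, a3.symm⟩
    · obtain ⟨_, h⟩ := hq.1 y hy hyk
      exact h.symm
  · obtain ⟨h1, -, -⟩ := R.chamber_eq_of_eq one_mem R.F_end hy hy fun k =>
      mul_pos_of_common_sign (hyk k) (hyk k)
    refine ⟨ψ' (chamber f' y h1), ⟨fun y' hy' hk => ?_, fun y' hy' hk => ?_⟩, fun q hq => ?_⟩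
    · obtain ⟨a1, a2, a3⟩ := R.chamberColour_eq hC hy' hy fun k =>
        mul_pos_of_common_sign (hk k) (hyk k)
      exact ⟨a1, a3⟩
    · obtain ⟨a1, a2, a3⟩ := R.chamber_eq_of_eq one_mem R.F_end hy hy' fun k =>
        mul_pos_of_common_sign (hyk k) (hk k)
      exact ⟨a2, by rw [← a3]⟩
    · obtain ⟨_, h⟩ := hq.2 y hy hyk
      exact h.symm

/-! ### The colours of the cells at the crossings -/

/-- The normals of two sheets at a common point are independent, as those of the hyperplanes
are. A third sheet `l` exists because there are `n + 2 ≥ 3` sheets. -/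
theorem linearIndependent_normal (hτ : τ ∈ Set.Icc (-1 : ℝ) 1) {i j l : Fin (n + 2)}
    (hij : i ≠ j) (hil : i ≠ l) (hjl : j ≠ l) {x u : M} (hx : x ∈ R.W j) (hu : u ∈ R.W i)
    (hxu : shadowMap (R.F τ) x = shadowMap (R.F τ) u) :
    LinearIndependent ℝ ![normal o (R.F τ) x, normal o (R.F τ) u] := by
  obtain ⟨c, hc, hcv⟩ := R.exists_inner_eq hτ hx hxu
  obtain ⟨d, hd, hdv⟩ := R.exists_inner_eq hτ hu rfl
  rw [LinearIndependent.pair_iff]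
  intro a b hab
  have key : ∀ v : E (n + 1), a * d * inner ℝ (R.L j) v + b * c * inner ℝ (R.L i) v = 0 := by
    intro v
    have := congrArg (fun w => inner ℝ w
      (fderiv ℝ (R.inv τ) (R.e τ (shadowMap (R.F τ) u)) v)) hab
    simp only [inner_add_left, real_inner_smul_left, inner_zero_left] at this
    rw [hcv, hdv]
    linear_combination c * d * this
  constructor
  · obtain ⟨v, hv⟩ := R.exists_direction l (fun k => if k = j then 1 else 0)
    have := key v
    rw [hv j hjl, hv i hil, if_pos rfl, if_neg hij] at this
    simpa [hd.ne'] using this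
  · obtain ⟨v, hv⟩ := R.exists_direction l (fun k => if k = i then 1 else 0)
    have := key v
    rw [hv j hjl, hv i hil, if_pos rfl, if_neg hij.symm] at this
    simpa [hc.ne'] using this

/-- The colours of the cells of the sheet `j` on the two sides of the sheet `i`: they are related
by the colouring rule if `i` is the higher sheet, and equal otherwise. -/
theorem cellColour_rule [CompactSpace M] [Shelf X] (hτ : τ ∈ Set.Icc (-1 : ℝ) 1)
    {g : M → E (n + 2)} (hg : R.F τ = g) (C : Colouring o g X) {i j l : Fin (n + 2)}
    (hij : i ≠ j) (hil : i ≠ l) (hjl : j ≠ l) {y : E (n + 1)} (hy : y ∈ R.U)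
    (hi : R.side τ i y = 0) (hj : R.side τ j y = 0)
    (hneg : ∀ k, k ≠ i → k ≠ j → R.side τ k y < 0) {qi qj r : X}
    (hqj : R.CellColour τ C.φ j (fun _ => -1) qj) (hqi : R.CellColour τ C.φ i (fun _ => -1) qi)
    (hr : R.CellColour τ C.φ j (Function.update (fun _ => -1) i 1) r) :
    r = if j < i then rmul qj qi else qj := by
  classical
  subst hg
  obtain ⟨x, hx, hxy⟩ := R.exists_mem_of_side_eq_zero hτ hy hj
  obtain ⟨u, hu, huy⟩ := R.exists_mem_of_side_eq_zero hτ hy hi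
  split_ifs with hlt
  · have hfib : fibre (R.F τ) (shadowMap (R.F τ) u) = {x, u} := by
      ext w
      simp only [fibre, Set.mem_ofPred_eq, Set.mem_insert_iff, Set.mem_singleton_iff]
      refine ⟨fun hw => ?_, ?_⟩
      · obtain ⟨k, hk⟩ := (R.mem_U_iff hτ w).1 (by rw [hw, huy]; exact hy)
        have h0 := R.side_eq_zero hτ hk
        rw [hw, huy] at h0
        by_cases hki : k = i
        · subst hki
          exact Or.inr (R.eq_of_shadowMap_eq hτ hk hu hw)
        · by_cases hkj : k = j
          · subst hkj
            exact Or.inl (R.eq_of_shadowMap_eq hτ hk hx (hw.trans (huy.trans hxy.symm)))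
          · exact absurd h0 (hneg k hki hkj).ne
      · rintro (rfl | rfl)
        · exact hxy.trans huy.symm
        · rfl
    -- The upper sheet has the colour `qi` at `u`: the lower sheet `j` does not separate regions.
    obtain ⟨y', hyU', hi', hj', hk'⟩ := R.exists_adjacent hτ hy j i l hjl hil hij.symm hj hi
      (ε := -1) (by norm_num)
    obtain ⟨u', hu', huy'⟩ := R.exists_mem_of_side_eq_zero hτ hyU' hi'
    obtain ⟨h1, h2, h3⟩ := R.region_eq hτ hu hu' fun k hk => by
      rw [huy, huy']
      exact hk' k (hneg k hk.ne' (hlt.trans hk).ne').ne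
    obtain ⟨h4, h5⟩ := hqi u' hu' fun k hk => by
      rw [huy']
      by_cases hkj : k = j
      · subst hkj; exact hj'
      · have h6 := hneg k hk hkj
        have := (pos_iff_pos_of_mul_pos (hk' k h6.ne)).not.1 h6.le.not_gt
        have h7 := hk' k h6.ne
        nlinarith
    have hcol : C.φ (region (R.F τ) u h1) = qi := by rw [h3, h5]
    rw [← hcol]
    refine (C.rule x u h1 hfib (R.order τ hτ j i hlt x hx u hu (hxy.trans huy.symm))
      (R.linearIndependent_normal hτ hij hil hjl hx hu (hxy.trans huy.symm)) qj r
      (hqj.regionColourBehind hτ hx fun k hk => ?_)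
      (hr.regionColourBehind hτ hx fun k hk => ?_)).symm
    · by_cases hki : k = i
      · subst hki
        exact Or.inr ⟨u, hu, huy.trans hxy.symm, Or.inl ⟨by norm_num, rfl⟩⟩
      · left
        rw [hxy]
        linarith [hneg k hki hk]
    · by_cases hki : k = i
      · subst hki
        exact Or.inr ⟨u, hu, huy.trans hxy.symm, Or.inr ⟨by simp, rfl⟩⟩
      · left
        rw [hxy, Function.update_of_ne hki]
        linarith [hneg k hki hk]
  · have hlt' : i < j := lt_of_le_of_ne (not_lt.1 hlt) hij
    obtain ⟨y₁, hU₁, hj₁, hi₁, hk₁⟩ := R.exists_adjacent hτ hy i j l hil hjl hij hi hj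
      (ε := -1) (by norm_num)
    obtain ⟨y₂, hU₂, hj₂, hi₂, hk₂⟩ := R.exists_adjacent hτ hy i j l hil hjl hij hi hj
      (ε := 1) (by norm_num)
    obtain ⟨x₁, hx₁, rfl⟩ := R.exists_mem_of_side_eq_zero hτ hU₁ hj₁
    obtain ⟨x₂, hx₂, rfl⟩ := R.exists_mem_of_side_eq_zero hτ hU₂ hj₂
    obtain ⟨a1, a2⟩ := hqj x₁ hx₁ fun k hk => by
      by_cases hki : k = i
      · subst hki; exact hi₁
      · have h6 := hneg k hki hk
        have h7 := hk₁ k h6.ne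
        nlinarith
    obtain ⟨b1, b2⟩ := hr x₂ hx₂ fun k hk => by
      by_cases hki : k = i
      · subst hki; simpa using hi₂
      · have h6 := hneg k hki hk
        have h7 := hk₂ k h6.ne
        rw [Function.update_of_ne hki]
        nlinarith
    obtain ⟨c1, c2, c3⟩ := R.region_eq hτ hx₁ hx₂ fun k hk => by
      have h6 := (hneg k (hlt'.trans hk).ne' hk.ne').ne
      exact mul_pos_of_common_sign (hk₁ k h6) (hk₂ k h6)
    rw [← a2, ← b2, c3]

/-- The colours of the chambers on the two sides of the sheet `i` are related by the rule for shadow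
colourings. -/
theorem chamberCellColour_rule [Shelf X] (hτ : τ ∈ Set.Icc (-1 : ℝ) 1)
    {g : M → E (n + 2)} (hg : R.F τ = g) (C : ShadowColouring o g X) {i : Fin (n + 2)}
    {y : E (n + 1)} (hy : y ∈ R.U) (hi : R.side τ i y = 0)
    (hneg : ∀ k, k ≠ i → R.side τ k y < 0) {qi q₀ r : X}
    (hq₀ : R.ChamberCellColour τ C.ψ (fun _ => -1) q₀)
    (hqi : R.CellColour τ C.φ i (fun _ => -1) qi)
    (hr : R.ChamberCellColour τ C.ψ (Function.update (fun _ => -1) i 1) r) :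
    r = rmul q₀ qi := by
  classical
  subst hg
  obtain ⟨x, hx, rfl⟩ := R.exists_mem_of_side_eq_zero hτ hy hi
  obtain ⟨h1, h2⟩ := hqi x hx fun k hk => by linarith [hneg k hk]
  have hfib : fibre (R.F τ) (shadowMap (R.F τ) x) = {x} := by
    ext w
    simp only [fibre, Set.mem_ofPred_eq, Set.mem_singleton_iff]
    refine ⟨fun hw => ?_, fun h => by rw [h]⟩
    obtain ⟨k, hk⟩ := (R.mem_U_iff hτ w).1 (by rw [hw]; exact hy)
    have h0 := R.side_eq_zero hτ hk
    rw [hw] at h0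
    by_cases hki : k = i
    · subst hki
      exact R.eq_of_shadowMap_eq hτ hk hx hw
    · exact absurd h0 (hneg k hki).ne
  have hnorm : normal o (R.F τ) x ≠ 0 := fun h0 => by
    have := R.coorientation τ hτ i x hx
    rw [h0, map_zero, inner_zero_right] at this
    exact lt_irrefl _ this
  rw [← h2]
  refine (C.shadow_rule x h1 hfib hnorm q₀ r
    (hq₀.chamberColourBehind hτ hy fun k => ?_)
    (hr.chamberColourBehind hτ hy fun k => ?_)).symm
  · by_cases hki : k = i
    · subst hki
      exact Or.inr ⟨x, hx, rfl, Or.inl ⟨by norm_num, rfl⟩⟩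
    · left
      linarith [hneg k hki]
  · by_cases hki : k = i
    · subst hki
      exact Or.inr ⟨x, hx, rfl, Or.inr ⟨by simp, rfl⟩⟩
    · left
      rw [Function.update_of_ne hki]
      linarith [hneg k hki]

/-- The colour of the cell of the sheet `j` that lies beyond the sheet `i` and on the source side of
all other sheets. The colouring rule is applied at a double point of the two sheets on the source
side of the others, which exists at one of the times `±1`; the colour of the cell at the other time
is the same. -/
theorem HasColour.beyond [CompactSpace M] [Shelf X] (hn : 1 ≤ n) {C : Colouring o f X}
    {C' : Colouring o f' X} (hC : R.Corresponds C C') {i j : Fin (n + 2)} (hij : i ≠ j)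
    {qi qj : X} (hqj : R.HasColour C C' j (fun _ => -1) qj)
    (hqi : R.HasColour C C' i (fun _ => -1) qi) :
    R.HasColour C C' j (Function.update (fun _ => -1) i 1) (if j < i then rmul qj qi else qj) := by
  classical
  obtain ⟨l, hil, hjl⟩ := exists_ne_ne hn i j
  obtain ⟨r, hr, -⟩ := R.existsUnique_hasColour hn hC j
    (σ := Function.update (fun _ => -1) i 1) fun k _ => by
      by_cases hk : k = i
      · subst hk; simp
      · rw [Function.update_of_ne hk]; norm_num
  obtain ⟨τ, hτ, y, hy, hcell⟩ := R.exists_mem_cell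
    (σ := fun k => if k = i ∨ k = j then 0 else -1) (k₀ := l)
    (by simp [hil.symm, hjl.symm])
  have hi : R.side τ i y = 0 := (hcell i).1 (by simp)
  have hj : R.side τ j y = 0 := (hcell j).1 (by simp)
  have hneg : ∀ k, k ≠ i → k ≠ j → R.side τ k y < 0 := fun k hki hkj => by
    have := (hcell k).2
    simp only [hki, hkj, or_self, if_false] at this
    linarith [this (by norm_num)]
  suffices r = if j < i then rmul qj qi else qj by rwa [← this]
  rcases hτ with rfl | rfl
  · exact R.cellColour_rule neg_one_mem R.F_start C hij hil hjl hy hi hj hneg hqj.1 hqi.1 hr.1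
  · exact R.cellColour_rule one_mem R.F_end C' hij hil hjl hy hi hj hneg hqj.2 hqi.2 hr.2

theorem HasChamberColour.beyond [Shelf X] (hn : 1 ≤ n) {C : ShadowColouring o f X}
    {C' : ShadowColouring o f' X} (hC : R.ShadowCorresponds C C') (i : Fin (n + 2))
    {qi q₀ : X} (hq₀ : R.HasChamberColour C.ψ C'.ψ (fun _ => -1) q₀)
    (hqi : R.HasColour C.toColouring C'.toColouring i (fun _ => -1) qi) :
    R.HasChamberColour C.ψ C'.ψ (Function.update (fun _ => -1) i 1) (rmul q₀ qi) := by
  classical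
  obtain ⟨l, hil, -⟩ := exists_ne_ne hn i i
  obtain ⟨r, hr, -⟩ := R.existsUnique_hasChamberColour hC.2
    (σ := Function.update (fun _ => -1) i 1) fun k => by
      by_cases hk : k = i
      · subst hk; simp
      · rw [Function.update_of_ne hk]; norm_num
  obtain ⟨τ, hτ, y, hy, hcell⟩ := R.exists_mem_cell
    (σ := fun k => if k = i then 0 else -1) (k₀ := l) (by simp [hil.symm])
  have hi : R.side τ i y = 0 := (hcell i).1 (by simp)
  have hneg : ∀ k, k ≠ i → R.side τ k y < 0 := fun k hki => by
    have := (hcell k).2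
    simp only [hki, if_false] at this
    linarith [this (by norm_num)]
  suffices r = rmul q₀ qi by rwa [← this]
  rcases hτ with rfl | rfl
  · exact R.chamberCellColour_rule neg_one_mem R.F_start C hy hi hneg hq₀.1 hqi.1 hr.1
  · exact R.chamberCellColour_rule one_mem R.F_end C' hy hi hneg hq₀.2 hqi.2 hr.2

theorem isLabel_iff [Shelf X] {C : Colouring o f X} {C' : Colouring o f' X}
    {q : Fin (n + 2) → X} :
    R.IsLabel C C' q ↔ ∀ i, R.HasColour C C' i (fun _ => -1) (q i) := by
  simp only [IsLabel, HasColour, CellColour, neg_one_mul, neg_pos]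
  exact ⟨fun h i => ⟨fun x hx => (h i x hx).1, fun x hx => (h i x hx).2⟩,
    fun h i x hx => ⟨(h i).1 x hx, (h i).2 x hx⟩⟩

theorem isShadowLabel_iff [Shelf X] {C : ShadowColouring o f X} {C' : ShadowColouring o f' X}
    {q : Fin (n + 3) → X} :
    R.IsShadowLabel C C' q ↔ R.IsLabel C.toColouring C'.toColouring (Fin.tail q) ∧
      R.HasChamberColour C.ψ C'.ψ (fun _ => -1) (q 0) := by
  simp only [IsShadowLabel, HasChamberColour, ChamberCellColour, neg_one_mul, neg_pos]
  exact ⟨fun h => ⟨h.1, fun y hy => (h.2 y hy).1, fun y hy => (h.2 y hy).2⟩,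
    fun h => ⟨h.1, fun y hy => ⟨h.2.1 y hy, h.2.2 y hy⟩⟩⟩

theorem existsUnique_isLabel [CompactSpace M] [Shelf X] (hn : 1 ≤ n) {C : Colouring o f X}
    {C' : Colouring o f' X} (hC : R.Corresponds C C') : ∃! q, R.IsLabel C C' q := by
  have h := fun j => R.existsUnique_hasColour hn hC j (σ := fun _ => -1) fun _ _ => by norm_num
  choose q hq hu using h
  exact ⟨q, R.isLabel_iff.2 hq, fun q' hq' => funext fun j => hu j _ (R.isLabel_iff.1 hq' j)⟩

theorem existsUnique_isShadowLabel [CompactSpace M] [Shelf X] (hn : 1 ≤ n)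
    {C : ShadowColouring o f X} {C' : ShadowColouring o f' X} (hC : R.ShadowCorresponds C C') :
    ∃! q, R.IsShadowLabel C C' q := by
  obtain ⟨q, hq, hu⟩ := R.existsUnique_isLabel hn hC.1
  obtain ⟨q₀, hq₀, hu₀⟩ := R.existsUnique_hasChamberColour hC.2 (σ := fun _ => -1)
    fun _ => by norm_num
  refine ⟨Fin.cons q₀ q, R.isShadowLabel_iff.2 ⟨by simpa using hq, by simpa using hq₀⟩,
    fun q' hq' => ?_⟩
  have h := R.isShadowLabel_iff.1 hq'
  rw [← Fin.cons_self_tail q', hu _ h.1, hu₀ _ h.2]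

end PassMove

end Manifold

/-! ### The crossings in the ball -/

section Manifold

variable {n : ℕ} {M : Type*} [TopologicalSpace M] [ChartedSpace (E n) M] [IsManifold (𝓡 n) ∞ M]
  {o : ManifoldOrientation n M} {f f' : M → E (n + 2)}

/-- The contribution of a crossing does not depend on a choice if its colours are unique. -/
theorem crossingChain_eq {X : Type*} [Shelf X] {g : M → E (n + 2)} {C : Colouring o g X}
    {x : Fin (n + 1) → M} {q : Fin (n + 1) → X} (h : ∀ q', IsCrossingColour C x q' ↔ q' = q) :
    crossingChain C x = crossingSign o g x • Finsupp.single q (1 : ℤ) := by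
  have hex : ∃ q', IsCrossingColour C x q' := ⟨q, (h q).2 rfl⟩
  rw [crossingChain, dif_pos hex, (h _).1 hex.choose_spec]

theorem shadowCrossingChain_eq {X : Type*} [Shelf X] {g : M → E (n + 2)}
    {C : ShadowColouring o g X} {x : Fin (n + 1) → M} {q : Fin (n + 2) → X}
    (h : ∀ q', IsCrossingColour C.toColouring x q' ↔ q' = Fin.tail q)
    (h₀ : ∀ q', IsSourceChamberColour C x q' ↔ q' = q 0) :
    shadowCrossingChain C x = crossingSign o g x • Finsupp.single q (1 : ℤ) := by
  have hex : ∃ q' : Fin (n + 2) → X, IsSourceChamberColour C x (q' 0) ∧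
      IsCrossingColour C.toColouring x (Fin.tail q') := ⟨q, (h₀ _).2 rfl, (h _).2 rfl⟩
  have hq : hex.choose = q := by
    rw [← Fin.cons_self_tail hex.choose, (h₀ _).1 hex.choose_spec.1, (h _).1 hex.choose_spec.2,
      Fin.cons_self_tail]
  rw [shadowCrossingChain, dif_pos hex, hq]

namespace PassMove

variable (R : PassMove o f f') {τ : ℝ}

/-- `x` is a crossing over the point `y` of `U` of all sheets except the sheet `i`. The
coefficient of the sheet `i` in the expression of time by the linear forms of the sheets decides on
which side of it the crossing lies. -/
structure IsCrossingOmitting (R : PassMove o f f') (τ : ℝ) (g : M → E (n + 2)) (i : Fin (n + 2))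
    (x : Fin (n + 1) → M) (y : E (n + 1)) : Prop where
  mem_W : ∀ a, x a ∈ R.W (i.succAbove a)
  mem_U : y ∈ R.U
  shadowMap_eq : ∀ a, shadowMap g (x a) = y
  side_pos : 0 < τ * timeCoeff R.L R.b i * R.side τ i y

theorem exists_isCrossingOmitting (hτ : τ ∈ Set.Icc (-1 : ℝ) 1) (hτ0 : τ ≠ 0) (i : Fin (n + 2)) :
    ∃ (x : Fin (n + 1) → M) (y : E (n + 1)), R.IsCrossingOmitting τ (R.F τ) i x y := by
  classical
  have hi := timeCoeff_ne_zero R.transverse R.time_generic i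
  obtain ⟨z, hz⟩ := exists_of_values R.transverse (Pi.single i (τ / timeCoeff R.L R.b i))
  have hsum : ∑ k, timeCoeff R.L R.b k *
      (Pi.single i (τ / timeCoeff R.L R.b i) : Fin (n + 2) → ℝ) k = τ := by
    rw [Finset.sum_eq_single i (fun k _ hk => by rw [Pi.single_eq_of_ne hk, mul_zero]) (by simp),
      Pi.single_eq_same]
    field_simp
  rw [hsum] at hz
  have hs : ∀ k, R.side τ k (R.inv τ z) =
      (Pi.single i (τ / timeCoeff R.L R.b i) : Fin (n + 2) → ℝ) k := fun k => by
    rw [R.side_inv hτ, hz]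
  have hx : ∀ a : Fin (n + 1), ∃ x ∈ R.W (i.succAbove a), shadowMap (R.F τ) x = R.inv τ z :=
    fun a => R.exists_mem_of_side_eq_zero hτ (R.inv_mem τ hτ z) (by
      rw [hs, Pi.single_eq_of_ne (Fin.succAbove_ne i a)])
  choose x hxW hxy using hx
  refine ⟨x, R.inv τ z, hxW, R.inv_mem τ hτ z, hxy, ?_⟩
  rw [hs, Pi.single_eq_same]
  have : τ * timeCoeff R.L R.b i * (τ / timeCoeff R.L R.b i) = τ * τ := by field_simp
  rw [this]
  exact mul_self_pos.2 hτ0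

namespace IsCrossingOmitting

variable {R} {i : Fin (n + 2)} {x : Fin (n + 1) → M} {y : E (n + 1)}

theorem side_eq_zero (h : R.IsCrossingOmitting τ (R.F τ) i x y) (hτ : τ ∈ Set.Icc (-1 : ℝ) 1)
    {k : Fin (n + 2)} (hk : k ≠ i) : R.side τ k y = 0 := by
  obtain ⟨a, rfl⟩ := Fin.exists_succAbove_eq hk
  rw [← h.shadowMap_eq a]
  exact R.side_eq_zero hτ (h.mem_W a)

theorem mem_crossings (h : R.IsCrossingOmitting τ (R.F τ) i x y)
    (hτ : τ ∈ Set.Icc (-1 : ℝ) 1) : x ∈ crossings (R.F τ) := by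
  refine ⟨fun a b hab => ?_, Set.Subset.antisymm ?_ fun w hw => ?_⟩
  · exact R.order τ hτ _ _ (Fin.strictMono_succAbove i hab) _ (h.mem_W a) _ (h.mem_W b)
      ((h.shadowMap_eq a).trans (h.shadowMap_eq b).symm)
  · rintro _ ⟨a, rfl⟩
    exact (h.shadowMap_eq a).trans (h.shadowMap_eq 0).symm
  · have hw : shadowMap (R.F τ) w = y := Eq.trans hw (h.shadowMap_eq 0)
    obtain ⟨k, hk⟩ := (R.mem_U_iff hτ w).1 (hw ▸ h.mem_U)
    have hki : k ≠ i := by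
      rintro rfl
      have h1 := h.side_pos
      rw [← hw, R.side_eq_zero hτ hk, mul_zero] at h1
      exact lt_irrefl _ h1
    obtain ⟨a, rfl⟩ := Fin.exists_succAbove_eq hki
    exact ⟨a, R.eq_of_shadowMap_eq hτ (h.mem_W a) hk ((h.shadowMap_eq a).trans hw.symm)⟩

/-- The crossing that omits the sheet `i` is unique, as the hyperplanes other than `V_i` meet in a
single point at each time. -/
theorem eq_of_mem_W (h : R.IsCrossingOmitting τ (R.F τ) i x y) (hτ : τ ∈ Set.Icc (-1 : ℝ) 1)
    {x' : Fin (n + 1) → M} (hx' : ∀ a, x' a ∈ R.W (i.succAbove a))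
    (heq : ∀ a, shadowMap (R.F τ) (x' a) = shadowMap (R.F τ) (x' 0)) : x' = x := by
  classical
  set y' := shadowMap (R.F τ) (x' 0) with hy'
  have hU' : y' ∈ R.U := R.mem_U hτ (hx' 0)
  have h0 : ∀ k, k ≠ i → R.side τ k y' = 0 := fun k hk => by
    obtain ⟨a, rfl⟩ := Fin.exists_succAbove_eq hk
    rw [← heq a]
    exact R.side_eq_zero hτ (hx' a)
  have hsum : ∀ w, (∀ k, k ≠ i → R.side τ k w = 0) → timeCoeff R.L R.b i * R.side τ i w = τ := by
    intro w hw
    have h1 := sum_timeCoeff R.transverse (R.e τ w) τ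
    rw [← Finset.add_sum_erase _ _ (Finset.mem_univ i), Finset.sum_eq_zero, add_zero] at h1
    · exact h1
    · intro k hk
      have := hw k (Finset.ne_of_mem_erase hk)
      rw [side] at this
      rw [this, mul_zero]
  have hi := timeCoeff_ne_zero R.transverse R.time_generic i
  have hyy : y' = y := by
    rw [← R.inv_e τ hτ y h.mem_U, ← R.inv_e τ hτ y' hU']
    congr 1
    refine eq_of_inner_eq R.transverse fun k => ?_
    suffices R.side τ k y' = R.side τ k y by
      simpa only [side, add_left_inj] using this
    by_cases hk : k = i
    · subst hk
      exact mul_left_cancel₀ hi ((hsum y' h0).trans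
        (hsum y fun k hk => h.side_eq_zero hτ hk).symm)
    · rw [h0 k hk, h.side_eq_zero hτ hk]
  funext a
  exact R.eq_of_shadowMap_eq hτ (hx' a) (h.mem_W a)
    ((heq a).trans (hyy.trans (h.shadowMap_eq a).symm))

/-- The sign of a crossing is that of the hyperplanes: normals and hyperplanes are related by the
transposed derivative of the orientation preserving coordinates and by positive factors. -/
theorem crossingSign_eq (h : R.IsCrossingOmitting τ (R.F τ) i x y)
    (hτ : τ ∈ Set.Icc (-1 : ℝ) 1) : crossingSign o (R.F τ) x =
      (SignType.sign (Matrix.of fun (a l : Fin (n + 1)) =>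
        R.L (i.succAbove a.rev) l).det : SignType) := by
  have h1 : ∀ a, ∃ c : ℝ, 0 < c ∧ ∀ w : E (n + 1),
      inner ℝ (R.L (i.succAbove a)) (fderiv ℝ (R.e τ) y w) =
        c * inner ℝ (normal o (R.F τ) (x a)) w := fun a => by
    rw [← h.shadowMap_eq a]
    exact R.exists_fderiv_side_eq hτ (h.mem_W a)
  choose c hc hcw using h1
  set T : Matrix (Fin (n + 1)) (Fin (n + 1)) ℝ :=
    LinearMap.toMatrix (EuclideanSpace.basisFun (Fin (n + 1)) ℝ).toBasis
      (EuclideanSpace.basisFun (Fin (n + 1)) ℝ).toBasis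
      (fderiv ℝ (R.e τ) y : E (n + 1) →ₗ[ℝ] E (n + 1)) with hT
  have hTdet : 0 < T.det := by
    rw [hT, LinearMap.det_toMatrix]
    exact R.orientation_e τ hτ y h.mem_U
  have hmul : (Matrix.of fun (a l : Fin (n + 1)) => R.L (i.succAbove a.rev) l) * T =
      Matrix.diagonal (fun a : Fin (n + 1) => c a.rev) *
        (Matrix.of fun a l : Fin (n + 1) => normal o (R.F τ) (x a.rev) l) := by
    ext a l
    rw [Matrix.mul_apply, Matrix.diagonal_mul]
    have h2 := hcw a.rev (EuclideanSpace.single l 1)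
    rw [inner_eq_sum, inner_eq_sum (normal o (R.F τ) (x a.rev))] at h2
    simpa [hT, LinearMap.toMatrix_apply] using h2
  have hdet := congrArg Matrix.det hmul
  rw [Matrix.det_mul, Matrix.det_mul, Matrix.det_diagonal] at hdet
  have hpos : 0 < ∏ a : Fin (n + 1), c a.rev := Finset.prod_pos fun a _ => hc _
  have hs := congrArg SignType.sign hdet
  rw [sign_mul, sign_mul, sign_pos hTdet, sign_pos hpos, mul_one, one_mul] at hs
  rw [crossingSign, hs]

/-- The colours at a crossing are those of the cells on the side of the omitted sheet where the
crossing lies. -/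
theorem isCrossingColour_iff [CompactSpace M] {X : Type*} [Shelf X] {C : Colouring o (R.F τ) X}
    (h : R.IsCrossingOmitting τ (R.F τ) i x y) (hτ : τ ∈ Set.Icc (-1 : ℝ) 1)
    {σ : Fin (n + 2) → ℝ} (hσ : ∀ k, k ≠ i → σ k < 0) (hσi : 0 < σ i * R.side τ i y)
    {q : Fin (n + 1) → X} (hq : ∀ a, R.CellColour τ C.φ (i.succAbove a) σ (q a))
    (q' : Fin (n + 1) → X) : IsCrossingColour C x q' ↔ q' = q := by
  have hq1 : IsCrossingColour C x q := fun a => by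
    refine (hq a).regionColourBehind hτ (h.mem_W a) fun k hk => ?_
    rw [h.shadowMap_eq]
    by_cases hki : k = i
    · subst hki
      exact Or.inl hσi
    · obtain ⟨b, rfl⟩ := Fin.exists_succAbove_eq hki
      exact Or.inr ⟨x b, h.mem_W b, h.shadowMap_eq b,
        Or.inl ⟨hσ _ hki, b, fun hb => hk (by rw [hb]), rfl⟩⟩
  refine ⟨fun hq' => funext fun a => ?_, fun h => h ▸ hq1⟩
  -- A direction along the sheet of `x a` to the source side of the other sheets of the crossing.
  obtain ⟨v, hv⟩ := R.exists_direction i (fun k => if k = i.succAbove a then 0 else -1)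
  refine R.regionColourBehind_unique hτ (h.mem_W a) ?_ (v := v) ?_ ?_ (hq' a) (hq1 a)
  · exact (Set.finite_range fun b => normal o (R.F τ) (x b)).subset
      (by rintro _ ⟨b, -, rfl⟩; exact ⟨b, rfl⟩)
  · rw [hv _ (Fin.succAbove_ne i a), if_pos rfl]
  · rintro _ ⟨b, hb, rfl⟩
    obtain ⟨c, hc, hcv⟩ := R.exists_inner_eq hτ (h.mem_W b)
      ((h.shadowMap_eq b).trans (h.shadowMap_eq a).symm)
    have h1 := hcv v
    rw [hv _ (Fin.succAbove_ne i b), if_neg fun hh => hb (Fin.succAbove_right_injective hh)] at h1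
    nlinarith

theorem isSourceChamberColour_iff {X : Type*} [Shelf X]
    {C : ShadowColouring o (R.F τ) X} (h : R.IsCrossingOmitting τ (R.F τ) i x y)
    (hτ : τ ∈ Set.Icc (-1 : ℝ) 1) {σ : Fin (n + 2) → ℝ} (hσ : ∀ k, k ≠ i → σ k < 0)
    (hσi : 0 < σ i * R.side τ i y) {q₀ : X} (hq₀ : R.ChamberCellColour τ C.ψ σ q₀) (q' : X) :
    IsSourceChamberColour C x q' ↔ q' = q₀ := by
  have hq1 : IsSourceChamberColour C x q₀ := by
    rw [IsSourceChamberColour, h.shadowMap_eq 0]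
    refine hq₀.chamberColourBehind hτ h.mem_U fun k => ?_
    by_cases hki : k = i
    · subst hki
      exact Or.inl hσi
    · obtain ⟨b, rfl⟩ := Fin.exists_succAbove_eq hki
      exact Or.inr ⟨x b, h.mem_W b, h.shadowMap_eq b, Or.inl ⟨hσ _ hki, b, rfl⟩⟩
  refine ⟨fun hq' => ?_, fun h => h ▸ hq1⟩
  obtain ⟨v, hv⟩ := R.exists_direction i (fun _ => -1)
  rw [IsSourceChamberColour, h.shadowMap_eq 0] at hq' hq1
  refine R.chamberColourBehind_unique hτ h.mem_U (Set.finite_range _) (v := v) ?_ hq' hq1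
  rintro _ ⟨b, rfl⟩
  obtain ⟨c, hc, hcv⟩ := R.exists_inner_eq hτ (h.mem_W b) (h.shadowMap_eq b)
  have h1 := hcv v
  rw [hv _ (Fin.succAbove_ne i b)] at h1
  have h1 : (-1 : ℝ) = c * _ := h1
  nlinarith

end IsCrossingOmitting

/-- Over `U` there are exactly `n + 2` crossings, one for each omitted sheet. -/
theorem exists_crossings (hτ : τ ∈ Set.Icc (-1 : ℝ) 1) (hτ0 : τ ≠ 0) :
    ∃ (x : Fin (n + 2) → Fin (n + 1) → M) (y : Fin (n + 2) → E (n + 1)),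
      (∀ i, R.IsCrossingOmitting τ (R.F τ) i (x i) (y i)) ∧ Function.Injective x ∧
      {w ∈ crossings (R.F τ) | shadowMap (R.F τ) (w 0) ∈ R.U} = Set.range x := by
  choose x y hxy using R.exists_isCrossingOmitting hτ hτ0
  refine ⟨x, y, hxy, fun i i' hii => ?_, Set.Subset.antisymm ?_ ?_⟩
  · refine Fin.succAbove_left_injective (funext fun a => ?_)
    exact R.eq_of_mem_W ((hxy i).mem_W a) (by rw [hii]; exact (hxy i').mem_W a)
  · rintro w ⟨⟨hmono, hfib⟩, hU⟩
    have heq : ∀ a, shadowMap (R.F τ) (w a) = shadowMap (R.F τ) (w 0) := fun a => by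
      have h1 : w a ∈ fibre (R.F τ) (shadowMap (R.F τ) (w 0)) := hfib ▸ ⟨a, rfl⟩
      exact h1
    have hk : ∀ a, ∃ k, w a ∈ R.W k := fun a => (R.mem_U_iff hτ _).1 (by rw [heq]; exact hU)
    choose k hk using hk
    have hkmono : StrictMono k := fun a b hab => by
      have hlt := hmono hab
      have hab' := (heq a).trans (heq b).symm
      rcases lt_trichotomy (k a) (k b) with h1 | h1 | h1
      · exact h1
      · have := R.eq_of_shadowMap_eq hτ (h1 ▸ hk a) (hk b) hab'
        simp only [this] at hlt
        exact absurd hlt (lt_irrefl _)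
      · exact absurd hlt (R.order τ hτ _ _ h1 _ (hk b) _ (hk a) hab'.symm).not_gt
    obtain ⟨i, hi⟩ := exists_eq_succAbove hkmono
    exact ⟨i, ((hxy i).eq_of_mem_W hτ (fun a => by rw [← hi]; exact hk a) heq).symm⟩
  · rintro _ ⟨i, rfl⟩
    exact ⟨(hxy i).mem_crossings hτ, by rw [(hxy i).shadowMap_eq]; exact (hxy i).mem_U⟩

end PassMove

end Manifold

/-! ### The diagrams outside the support -/

theorem shadowMap_notMem_of_mem_crossings {n : ℕ} {M : Type*} {K : Set (E (n + 1))}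
    {g : M → E (n + 2)} {x : Fin (n + 1) → M} (hx : x ∈ crossings g)
    (hK : shadowMap g (x 0) ∉ K) (a : Fin (n + 1)) : shadowMap g (x a) ∉ K := by
  have h2 : x a ∈ fibre g (shadowMap g (x 0)) := hx.2 ▸ ⟨a, rfl⟩
  have h2 : shadowMap g (x a) = shadowMap g (x 0) := h2
  rwa [h2]

section Topological

variable {n : ℕ} {M : Type*} [TopologicalSpace M]

/-- The diagrams of `g` and `g'` agree outside the closed set `K`: a point that either of them
projects to the complement of `K` has the same image under both. -/
structure AgreeOutside (K : Set (E (n + 1))) (g g' : M → E (n + 2)) : Prop where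
  isClosed : IsClosed K
  continuous_left : Continuous (shadowMap g)
  continuous_right : Continuous (shadowMap g')
  eq_left : ∀ x, shadowMap g x ∉ K → g' x = g x
  eq_right : ∀ x, shadowMap g' x ∉ K → g x = g' x

namespace AgreeOutside

variable {K : Set (E (n + 1))} {g g' : M → E (n + 2)}

theorem symm (h : AgreeOutside K g g') : AgreeOutside K g' g :=
  ⟨h.isClosed, h.continuous_right, h.continuous_left, h.eq_right, h.eq_left⟩

theorem shadowMap_eq (h : AgreeOutside K g g') {x : M} (hx : shadowMap g x ∉ K) :
    shadowMap g' x = shadowMap g x := by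
  simp only [shadowMap, h.eq_left x hx]

theorem eventually_notMem (h : AgreeOutside K g g') {x : M} (hx : shadowMap g x ∉ K) :
    ∀ᶠ x' in 𝓝 x, shadowMap g x' ∉ K :=
  h.continuous_left.continuousAt.eventually (h.isClosed.isOpen_compl.mem_nhds hx)

theorem fibre_eq (h : AgreeOutside K g g') {y : E (n + 1)} (hy : y ∉ K) :
    fibre g' y = fibre g y := by
  ext x
  constructor
  · rintro rfl
    exact h.symm.shadowMap_eq hy
  · rintro rfl
    exact h.shadowMap_eq hy

theorem mem_crossings (h : AgreeOutside K g g') {x : Fin (n + 1) → M} (hx : x ∈ crossings g)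
    (hK : shadowMap g (x 0) ∉ K) : x ∈ crossings g' := by
  have h1 : ∀ a, g' (x a) = g (x a) := fun a => by
    have h2 : x a ∈ fibre g (shadowMap g (x 0)) := hx.2 ▸ ⟨a, rfl⟩
    have h2 : shadowMap g (x a) = shadowMap g (x 0) := h2
    exact h.eq_left _ (h2 ▸ hK)
  refine ⟨?_, ?_⟩
  · simp only [h1]
    exact hx.1
  · rw [hx.2, h.shadowMap_eq hK, h.fibre_eq hK]

theorem notMem_lowerDecker (h : AgreeOutside K g g') {x : M} (hx : shadowMap g x ∉ K)
    (hd : x ∉ lowerDecker g) : x ∉ lowerDecker g' := by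
  rw [lowerDecker, mem_closure_iff_frequently, Filter.not_frequently] at hd ⊢
  filter_upwards [hd, h.eventually_notMem hx] with w hw hwK
  rintro ⟨u, hu, hlt⟩
  rw [h.shadowMap_eq hwK] at hu
  have huK : shadowMap g' u ∉ K := hu ▸ hwK
  have hu' := h.eq_right u huK
  refine hw ⟨u, ?_, ?_⟩
  · rw [← h.symm.shadowMap_eq huK] at hu
    exact hu
  · rwa [hu', ← h.eq_left w hwK]

theorem regionColourBehind (h : AgreeOutside K g g') {X : Type*} {φ : Region g → X}
    {φ' : Region g' → X} (hφ : ∀ (x : M) (h : x ∉ lowerDecker g) (h' : x ∉ lowerDecker g'),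
      shadowMap g x ∉ K → φ (region g x h) = φ' (region g' x h')) {x : M}
    (hx : shadowMap g x ∉ K) {N : Set (E (n + 1))} {q : X} (hq : RegionColourBehind g φ x N q) :
    RegionColourBehind g' φ' x N q := by
  intro c hc
  filter_upwards [hq c hc, h.eventually_notMem hx] with x' hx' hK hb
  rw [h.shadowMap_eq hK, h.shadowMap_eq hx] at hb
  obtain ⟨h1, h2⟩ := hx' hb
  exact ⟨h.notMem_lowerDecker hK h1, by rw [← h2, hφ]; exact hK⟩

theorem chamberColourBehind (h : AgreeOutside K g g') {X : Type*} {ψ : Chamber g → X}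
    {ψ' : Chamber g' → X} (hψ : ∀ (y : E (n + 1)) (h : y ∉ Set.range (shadowMap g))
      (h' : y ∉ Set.range (shadowMap g')), y ∉ K → ψ (chamber g y h) = ψ' (chamber g' y h'))
    {y : E (n + 1)} (hy : y ∉ K) {N : Set (E (n + 1))} {q : X}
    (hq : ChamberColourBehind g ψ y N q) : ChamberColourBehind g' ψ' y N q := by
  intro c hc
  filter_upwards [hq c hc, h.isClosed.isOpen_compl.mem_nhds hy] with y' hy' hK hb
  obtain ⟨h1, h2⟩ := hy' hb
  have h3 : y' ∉ Set.range (shadowMap g') := by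
    rintro ⟨x, rfl⟩
    exact h1 ⟨x, h.symm.shadowMap_eq hK⟩
  exact ⟨h3, by rw [← h2, hψ]; exact hK⟩

theorem colour_symm (h : AgreeOutside K g g') {X : Type*} {φ : Region g → X} {φ' : Region g' → X}
    (hφ : ∀ (x : M) (h : x ∉ lowerDecker g) (h' : x ∉ lowerDecker g'),
      shadowMap g x ∉ K → φ (region g x h) = φ' (region g' x h')) (x : M)
    (h₁ : x ∉ lowerDecker g') (h₂ : x ∉ lowerDecker g) (hx : shadowMap g' x ∉ K) :
    φ' (region g' x h₁) = φ (region g x h₂) :=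
  (hφ x h₂ h₁ (by rwa [h.symm.shadowMap_eq hx])).symm

end AgreeOutside

end Topological

section Manifold

variable {n : ℕ} {M : Type*} [TopologicalSpace M] [ChartedSpace (E n) M] [IsManifold (𝓡 n) ∞ M]
  {o : ManifoldOrientation n M} {f f' : M → E (n + 2)}

namespace AgreeOutside

variable {K : Set (E (n + 1))} {g g' : M → E (n + 2)}

theorem normal_eq (h : AgreeOutside K g g') {x : M} (hx : shadowMap g x ∉ K) :
    normal o g' x = normal o g x := by
  have h1 : shadowMap g' =ᶠ[𝓝 x] shadowMap g := by
    filter_upwards [h.eventually_notMem hx] with x' hx' using h.shadowMap_eq hx'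
  have h2 : tangentVec g' x = tangentVec g x := funext fun j => by
    exact congrArg (fun (l : E n →L[ℝ] E (n + 1)) => l (EuclideanSpace.single j (1 : ℝ)))
      (h1.mfderiv_eq (I := 𝓡 n) (I' := 𝓘(ℝ, E (n + 1))))
  simp only [normal, h2]

variable {X : Type*} [Shelf X]

theorem isCrossingColour (h : AgreeOutside K g g') {C : Colouring o g X} {C' : Colouring o g' X}
    (hC : ∀ (x : M) (h : x ∉ lowerDecker g) (h' : x ∉ lowerDecker g'),
      shadowMap g x ∉ K → C.φ (region g x h) = C'.φ (region g' x h'))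
    {x : Fin (n + 1) → M} (hx : ∀ a, shadowMap g (x a) ∉ K) {q : Fin (n + 1) → X}
    (hq : IsCrossingColour C x q) : IsCrossingColour C' x q := by
  intro i
  simp only [fun j => h.normal_eq (o := o) (hx j)]
  exact h.regionColourBehind hC (hx i) (hq i)

theorem isSourceChamberColour (h : AgreeOutside K g g') {C : ShadowColouring o g X}
    {C' : ShadowColouring o g' X} (hC : ∀ (y : E (n + 1)) (h : y ∉ Set.range (shadowMap g))
      (h' : y ∉ Set.range (shadowMap g')), y ∉ K → C.ψ (chamber g y h) = C'.ψ (chamber g' y h'))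
    {x : Fin (n + 1) → M} (hx : ∀ a, shadowMap g (x a) ∉ K) {q : X}
    (hq : IsSourceChamberColour C x q) : IsSourceChamberColour C' x q := by
  unfold IsSourceChamberColour at hq ⊢
  simp only [fun j => h.normal_eq (o := o) (hx j)]
  rw [h.shadowMap_eq (hx 0)]
  exact h.chamberColourBehind hC (hx 0) hq

theorem crossingSign_eq (h : AgreeOutside K g g') {x : Fin (n + 1) → M}
    (hx : ∀ a, shadowMap g (x a) ∉ K) : crossingSign o g' x = crossingSign o g x := by
  simp only [crossingSign, fun j => h.normal_eq (o := o) (hx j)]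

theorem crossingChain_eq (h : AgreeOutside K g g') {C : Colouring o g X} {C' : Colouring o g' X}
    (hC : ∀ (x : M) (h : x ∉ lowerDecker g) (h' : x ∉ lowerDecker g'),
      shadowMap g x ∉ K → C.φ (region g x h) = C'.φ (region g' x h'))
    {x : Fin (n + 1) → M} (hx : ∀ a, shadowMap g (x a) ∉ K) :
    crossingChain C' x = crossingChain C x := by
  have hx' : ∀ a, shadowMap g' (x a) ∉ K := fun a => by rw [h.shadowMap_eq (hx a)]; exact hx a
  have h1 : IsCrossingColour C' x = IsCrossingColour C x := funext fun q => propext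
    ⟨h.symm.isCrossingColour (h.colour_symm hC) hx', h.isCrossingColour hC hx⟩
  unfold crossingChain
  rw [h.crossingSign_eq hx]
  generalize IsCrossingColour C' x = P at h1 ⊢
  subst h1
  rfl

theorem shadowCrossingChain_eq (h : AgreeOutside K g g') {C : ShadowColouring o g X}
    {C' : ShadowColouring o g' X}
    (hC : ∀ (x : M) (h : x ∉ lowerDecker g) (h' : x ∉ lowerDecker g'),
      shadowMap g x ∉ K → C.φ (region g x h) = C'.φ (region g' x h'))
    (hψ : ∀ (y : E (n + 1)) (h : y ∉ Set.range (shadowMap g))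
      (h' : y ∉ Set.range (shadowMap g')), y ∉ K → C.ψ (chamber g y h) = C'.ψ (chamber g' y h'))
    {x : Fin (n + 1) → M} (hx : ∀ a, shadowMap g (x a) ∉ K) :
    shadowCrossingChain C' x = shadowCrossingChain C x := by
  have hx' : ∀ a, shadowMap g' (x a) ∉ K := fun a => by rw [h.shadowMap_eq (hx a)]; exact hx a
  have h1 : IsCrossingColour C'.toColouring x = IsCrossingColour C.toColouring x :=
    funext fun q => propext
      ⟨h.symm.isCrossingColour (h.colour_symm hC) hx', h.isCrossingColour hC hx⟩
  have h2 : IsSourceChamberColour C' x = IsSourceChamberColour C x := funext fun q => propext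
    ⟨h.symm.isSourceChamberColour (fun y a b hy => (hψ y b a hy).symm) hx',
      h.isSourceChamberColour hψ hx⟩
  unfold shadowCrossingChain
  rw [h.crossingSign_eq hx]
  generalize IsCrossingColour C'.toColouring x = P at h1 ⊢
  generalize IsSourceChamberColour C' x = P₀ at h2 ⊢
  subst h1 h2
  rfl

end AgreeOutside

theorem PassMove.agreeOutside (R : PassMove o f f') : AgreeOutside R.K f f' where
  isClosed := R.isCompact_K.isClosed
  continuous_left := by
    have := R.continuous_shadowMap PassMove.neg_one_mem
    rwa [R.F_start] at this
  continuous_right := by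
    have := R.continuous_shadowMap PassMove.one_mem
    rwa [R.F_end] at this
  eq_left x hx := (congrFun R.F_end x).symm.trans (R.fixed 1 PassMove.one_mem x hx)
  eq_right x hx := by
    have hx' : shadowMap (R.F 1) x ∉ R.K := by rw [R.F_end]; exact hx
    exact (R.F_eq_of_notMem PassMove.one_mem hx').2.symm.trans (congrFun R.F_end x)

/-! ### The chains of the two diagrams -/

/-- A crossing is determined by its projection, because its points are ordered by height. -/
theorem finite_crossings {g : M → E (n + 2)} (hg : IsRegular o g) : (crossings g).Finite := by
  refine Set.Finite.of_finite_image (f := fun x => shadowMap g (x 0))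
    (hg.finite_crossings.subset ?_) ?_
  · rintro _ ⟨x, hx, rfl⟩
    have hinj : Function.Injective x := fun a b hab => hx.1.injective (by simp only [hab])
    simp only [Set.mem_ofPred_eq]
    rw [← hx.2, ← Set.image_univ, hinj.encard_image]
    simp
  · intro x hx x' hx' hxx
    have hxx : shadowMap g (x 0) = shadowMap g (x' 0) := hxx
    have hr : Set.range x = Set.range x' := by rw [hx.2, hx'.2, hxx]
    have h1 : (fun i => height (g (x i))) = fun i => height (g (x' i)) := by
      refine (hx.1.range_inj hx'.1).1 ?_
      have h2 : ∀ w : Fin (n + 1) → M, Set.range (fun i => height (g (w i))) =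
        (fun u => height (g u)) '' Set.range w := fun w => Set.range_comp (fun u => height (g u)) w
      rw [h2, h2, hr]
    funext i
    obtain ⟨k, hk⟩ : x i ∈ Set.range x' := hr ▸ ⟨i, rfl⟩
    have h3 := congrFun h1 i
    simp only [← hk] at h3
    rw [← hk, hx'.1.injective h3]

/-- The sum over the crossings of a diagram splits into the part outside `U` and the `n + 2`
crossings in `U`. -/
theorem finsum_crossings {A : Type*} [AddCommMonoid A] {g : M → E (n + 2)} (hg : IsRegular o g)
    {U : Set (E (n + 1))} {x : Fin (n + 2) → Fin (n + 1) → M} (hx : Function.Injective x)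
    (hU : {w ∈ crossings g | shadowMap g (w 0) ∈ U} = Set.range x) (F : (Fin (n + 1) → M) → A) :
    ∑ᶠ w ∈ crossings g, F w =
      (∑ᶠ w ∈ {w ∈ crossings g | shadowMap g (w 0) ∉ U}, F w) + ∑ i, F (x i) := by
  have h1 : crossings g = {w ∈ crossings g | shadowMap g (w 0) ∉ U} ∪ Set.range x := by
    rw [← hU]
    ext w
    simp only [Set.mem_union, Set.mem_ofPred_eq]
    tauto
  have h2 : Disjoint {w ∈ crossings g | shadowMap g (w 0) ∉ U} (Set.range x) := by
    rw [← hU, Set.disjoint_left]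
    rintro w ⟨-, h3⟩ ⟨-, h4⟩
    exact h3 h4
  conv_lhs => rw [h1]
  rw [finsum_mem_union h2 ((finite_crossings hg).subset (Set.sep_subset _ _))
    (Set.finite_range x), finsum_mem_range hx, finsum_eq_sum_of_fintype (fun i => F (x i))]

/-- The contributions of the crossings outside `U` to the two diagrams cancel. -/
theorem finsum_crossings_sub {A : Type*} [AddCommGroup A] (R : PassMove o f f')
    {F F' : (Fin (n + 1) → M) → A} (hf : IsRegular o f) (hf' : IsRegular o f')
    (hF : ∀ w ∈ crossings f, shadowMap f (w 0) ∉ R.K → F' w = F w)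
    {x x' : Fin (n + 2) → Fin (n + 1) → M} (hx : Function.Injective x)
    (hx' : Function.Injective x')
    (hU : {w ∈ crossings f | shadowMap f (w 0) ∈ R.U} = Set.range x)
    (hU' : {w ∈ crossings f' | shadowMap f' (w 0) ∈ R.U} = Set.range x') :
    ∑ᶠ w ∈ crossings f, F w - ∑ᶠ w ∈ crossings f', F' w = ∑ i, (F (x i) - F' (x' i)) := by
  have hag := R.agreeOutside
  have hset : {w ∈ crossings f' | shadowMap f' (w 0) ∉ R.U} =
      {w ∈ crossings f | shadowMap f (w 0) ∉ R.U} := by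
    ext w
    constructor
    · rintro ⟨h1, h2⟩
      have h3 : shadowMap f' (w 0) ∉ R.K := fun h => h2 (R.K_subset h)
      exact ⟨hag.symm.mem_crossings h1 h3, by rwa [hag.symm.shadowMap_eq h3]⟩
    · rintro ⟨h1, h2⟩
      have h3 : shadowMap f (w 0) ∉ R.K := fun h => h2 (R.K_subset h)
      exact ⟨hag.mem_crossings h1 h3, by rwa [hag.shadowMap_eq h3]⟩
  rw [finsum_crossings hf hx hU, finsum_crossings hf' hx' hU', hset, Finset.sum_sub_distrib,
    finsum_mem_congr rfl fun w hw => hF w hw.1 fun h => hw.2 (R.K_subset h)]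
  abel

end Manifold

/-! ### Algebra of the boundary -/

theorem faceZero_succ {X : Type*} {k : ℕ} (i : Fin (k + 1)) (q : Fin (k + 2) → X) :
    faceZero i.succ q = Fin.cons (q 0) (faceZero i (Fin.tail q)) := by
  funext a
  refine Fin.cases ?_ (fun a => ?_) a
  · simp [faceZero]
  · simp [faceZero, Fin.tail]

theorem faceStar_succ {X : Type*} [Shelf X] {k : ℕ} (i : Fin (k + 1)) (q : Fin (k + 2) → X) :
    faceStar i.succ q = Fin.cons (rmul (q 0) (q i.succ)) (faceStar i (Fin.tail q)) := by
  funext a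
  refine Fin.cases ?_ (fun a => ?_) a
  · simp [faceStar]
  · simp only [faceStar, Fin.succ_succAbove_succ, Fin.cons_succ, Fin.tail, Fin.castSucc_succ,
      Fin.succ_lt_succ_iff]

theorem faceStar_zero {X : Type*} [Shelf X] {k : ℕ} (q : Fin (k + 1) → X) :
    faceStar 0 q = faceZero 0 q := by
  funext a
  simp [faceStar, faceZero]

theorem boundary_single {X : Type*} [Shelf X] {k : ℕ} (q : Fin (k + 1) → X) :
    boundary X k (Finsupp.single q 1) = boundaryGen q := by
  simp [boundary]

/-- The faces of a tuple at its first entry coincide, so only the other entries contribute to its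
boundary. -/
theorem boundaryGen_eq_neg_sum {X : Type*} [Shelf X] {k : ℕ} (q : Fin (k + 2) → X) :
    boundaryGen q = -∑ i : Fin (k + 1), ((-1 : ℤ) ^ ((i : ℕ) + 1)) •
      (Finsupp.single (faceZero i.succ q) (1 : ℤ) -
        Finsupp.single (faceStar i.succ q) (1 : ℤ)) := by
  unfold boundaryGen
  rw [Fin.sum_univ_succ, faceStar_zero, sub_self, smul_zero, zero_add, ← Finset.sum_neg_distrib]
  refine Finset.sum_congr rfl fun i _ => ?_
  rw [Fin.val_succ, pow_succ _ ((i : ℕ) + 1), mul_neg_one, neg_smul]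

/-- The faces before the move minus those after it, with the signs of the crossings. For either sign
of `c i`, the difference is the same multiple of `a i - b i`: if the two faces change roles, so does
the sign of the crossing. -/
theorem sum_faces_eq {A : Type*} [AddCommGroup A] {m : ℕ} (ε : ℤˣ) {c : Fin m → ℝ}
    (hc : ∀ i, c i ≠ 0) (a b : Fin m → A) :
    ∑ i : Fin m, (((ε : ℤ) * (-1) ^ (i : ℕ) * (SignType.sign (c i) : SignType)) •
        (if 0 < -1 * c i then b i else a i) -
      ((ε : ℤ) * (-1) ^ (i : ℕ) * (SignType.sign (c i) : SignType)) •
        (if 0 < 1 * c i then b i else a i)) =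
      -(ε : ℤ) • ∑ i : Fin m, ((-1 : ℤ) ^ ((i : ℕ) + 1)) • (a i - b i) := by
  rw [Finset.smul_sum]
  refine Finset.sum_congr rfl fun i _ => ?_
  rw [smul_smul]
  rcases (hc i).lt_or_gt with h | h
  · rw [if_pos (by linarith), if_neg (by linarith), sign_neg h]
    simp only [SignType.coe_neg_one, pow_succ]
    module
  · rw [if_neg (by linarith), if_pos (by linarith), sign_pos h]
    simp only [SignType.coe_one, pow_succ]
    module

theorem quandleHomologous_of_sub_eq {X : Type*} [Quandle X] {k : ℕ} {c c' : RackChain X (k + 1)}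
    {ε : ℤ} {d : RackChain X (k + 2)} (h : c - c' = ε • boundary X (k + 1) d) :
    QuandleHomologous c c' := by
  refine ⟨ε • toQuandleChain d, ?_⟩
  rw [map_smul]
  have h1 : toQuandleChain c - toQuandleChain c' = toQuandleChain (c - c') :=
    (map_sub (degenerate X (k + 1)).mkQ c c').symm
  have h2 : toQuandleChain (ε • boundary X (k + 1) d) = ε • toQuandleChain (boundary X (k + 1) d) :=
    map_smul (degenerate X (k + 1)).mkQ ε _
  rw [h1, h, h2]
  rfl

theorem QuandleHomologous.homologyClass_eq {X : Type*} [Quandle X] {k : ℕ}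
    {c c' : RackChain X (k + 1)} (h : QuandleHomologous c c') (hc : IsQuandleCycle c)
    (hc' : IsQuandleCycle c') : homologyClass c hc = homologyClass c' hc' :=
  (Submodule.Quotient.eq _).2 h

/-! ### The effect of the move on the chains -/

section Manifold

variable {n : ℕ} {M : Type*} [TopologicalSpace M] [ChartedSpace (E n) M] [IsManifold (𝓡 n) ∞ M]
  {o : ManifoldOrientation n M} {f f' : M → E (n + 2)}

namespace PassMove

variable (R : PassMove o f f') {τ : ℝ} {X : Type*} [Shelf X]

/-- The signs of the cells on the side of the sheet `i` where, at time `τ`, the crossing of the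
other sheets lies. -/
def crossingCell (R : PassMove o f f') (τ : ℝ) (i : Fin (n + 2)) : Fin (n + 2) → ℝ :=
  if 0 < τ * timeCoeff R.L R.b i then Function.update (fun _ => -1) i 1 else fun _ => -1

theorem crossingCell_neg {i k : Fin (n + 2)} (hk : k ≠ i) : R.crossingCell τ i k < 0 := by
  unfold crossingCell
  split_ifs
  · rw [Function.update_of_ne hk]; norm_num
  · norm_num

theorem IsCrossingOmitting.crossingCell_mul_side_pos {R : PassMove o f f'} {g : M → E (n + 2)}
    {i : Fin (n + 2)} {x : Fin (n + 1) → M} {y : E (n + 1)} (h : R.IsCrossingOmitting τ g i x y) :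
    0 < R.crossingCell τ i i * R.side τ i y := by
  have hs := h.side_pos
  unfold crossingCell
  split_ifs with h1
  · simpa using (mul_pos_iff_of_pos_left h1).1 hs
  · rcases mul_pos_iff.1 hs with h2 | h2
    · exact absurd h2.1 h1
    · linarith [h2.2]

theorem isCrossingColour_iff_eq [CompactSpace M] (hτ : τ ∈ Set.Icc (-1 : ℝ) 1)
    {g : M → E (n + 2)} (hg : R.F τ = g) {C : Colouring o g X} {q : Fin (n + 2) → X}
    (hq : ∀ j, R.CellColour τ C.φ j (fun _ => -1) (q j))
    (hq' : ∀ i j, i ≠ j → R.CellColour τ C.φ j (Function.update (fun _ => -1) i 1)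
      (if j < i then rmul (q j) (q i) else q j)) {i : Fin (n + 2)} {x : Fin (n + 1) → M}
    {y : E (n + 1)} (hx : R.IsCrossingOmitting τ (R.F τ) i x y) (q'' : Fin (n + 1) → X) :
    IsCrossingColour C x q'' ↔
      q'' = if 0 < τ * timeCoeff R.L R.b i then faceStar i q else faceZero i q := by
  subst hg
  refine hx.isCrossingColour_iff hτ (σ := R.crossingCell τ i) (fun k => R.crossingCell_neg)
    hx.crossingCell_mul_side_pos (fun a => ?_) q''
  unfold crossingCell
  split_ifs with h1
  · have := hq' i (i.succAbove a) (Fin.succAbove_ne i a).symm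
    simpa only [faceStar, Fin.succAbove_lt_iff_castSucc_lt] using this
  · exact hq _

theorem isSourceChamberColour_iff_eq (hτ : τ ∈ Set.Icc (-1 : ℝ) 1)
    {g : M → E (n + 2)} (hg : R.F τ = g) {C : ShadowColouring o g X} {q₀ : X}
    {q : Fin (n + 2) → X} (hq₀ : R.ChamberCellColour τ C.ψ (fun _ => -1) q₀)
    (hq₀' : ∀ i, R.ChamberCellColour τ C.ψ (Function.update (fun _ => -1) i 1) (rmul q₀ (q i)))
    {i : Fin (n + 2)} {x : Fin (n + 1) → M} {y : E (n + 1)}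
    (hx : R.IsCrossingOmitting τ (R.F τ) i x y) (q' : X) :
    IsSourceChamberColour C x q' ↔
      q' = if 0 < τ * timeCoeff R.L R.b i then rmul q₀ (q i) else q₀ := by
  subst hg
  refine hx.isSourceChamberColour_iff hτ (σ := R.crossingCell τ i) (fun k => R.crossingCell_neg)
    hx.crossingCell_mul_side_pos ?_ q'
  unfold crossingCell
  split_ifs with h1
  · exact hq₀' i
  · exact hq₀

/-- The sign `ε` comes from the geometry of the sheets alone. In the shadow chain, the positions in
the label are shifted by one, which reverses the sign. -/
theorem exists_chain_sub_eq [CompactSpace M] (hn : 1 ≤ n) (hf : IsRegular o f)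
    (hf' : IsRegular o f') (X : Type*) [Shelf X] :
    ∃ ε : ℤˣ, (∀ (C : Colouring o f X) (C' : Colouring o f' X), R.Corresponds C C' →
      ∀ q : Fin (n + 2) → X, R.IsLabel C C' q →
        chain C - chain C' = -(ε : ℤ) • boundary X (n + 1) (Finsupp.single q 1)) ∧
      ∀ (C : ShadowColouring o f X) (C' : ShadowColouring o f' X), R.ShadowCorresponds C C' →
        ∀ q : Fin (n + 3) → X, R.IsShadowLabel C C' q →
          shadowChain C - shadowChain C' =
            (ε : ℤ) • boundary X (n + 2) (Finsupp.single q 1) := by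
  obtain ⟨ε, hε⟩ := exists_sign_det_eq R.transverse
  have hlam := timeCoeff_ne_zero R.transverse R.time_generic
  obtain ⟨x, y, hx, hxinj, hxU⟩ := R.exists_crossings neg_one_mem (by norm_num)
  obtain ⟨x', y', hx', hxinj', hxU'⟩ := R.exists_crossings one_mem (by norm_num)
  have hs : ∀ i, crossingSign o f (x i) =
      (ε : ℤ) * (-1) ^ (i : ℕ) * (SignType.sign (timeCoeff R.L R.b i) : SignType) := fun i => by
    rw [← hε, ← (hx i).crossingSign_eq neg_one_mem, R.F_start]
  have hs' : ∀ i, crossingSign o f' (x' i) =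
      (ε : ℤ) * (-1) ^ (i : ℕ) * (SignType.sign (timeCoeff R.L R.b i) : SignType) := fun i => by
    rw [← hε, ← (hx' i).crossingSign_eq one_mem, R.F_end]
  rw [R.F_start] at hxU
  rw [R.F_end] at hxU'
  have hcol : ∀ (C : Colouring o f X) (C' : Colouring o f' X), R.Corresponds C C' →
      ∀ q : Fin (n + 2) → X, R.IsLabel C C' q → ∀ i,
        (∀ q'', IsCrossingColour C (x i) q'' ↔
          q'' = if 0 < -1 * timeCoeff R.L R.b i then faceStar i q else faceZero i q) ∧
        (∀ q'', IsCrossingColour C' (x' i) q'' ↔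
          q'' = if 0 < 1 * timeCoeff R.L R.b i then faceStar i q else faceZero i q) := by
    intro C C' hC q hq i
    have hq := R.isLabel_iff.1 hq
    have hb := fun i j (hij : i ≠ j) => HasColour.beyond R hn hC hij (hq j) (hq i)
    exact ⟨R.isCrossingColour_iff_eq neg_one_mem R.F_start (fun j => (hq j).1)
        (fun i j hij => (hb i j hij).1) (hx i),
      R.isCrossingColour_iff_eq one_mem R.F_end (fun j => (hq j).2)
        (fun i j hij => (hb i j hij).2) (hx' i)⟩
  refine ⟨ε, fun C C' hC q hq => ?_, fun C C' hC q hq => ?_⟩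
  · have h1 : ∀ w ∈ crossings f, shadowMap f (w 0) ∉ R.K →
        crossingChain C' w = crossingChain C w := fun w hw hK =>
      R.agreeOutside.crossingChain_eq hC (shadowMap_notMem_of_mem_crossings hw hK)
    unfold chain
    rw [finsum_crossings_sub R hf hf' h1 hxinj hxinj' hxU hxU', boundary_single]
    unfold boundaryGen
    rw [← sum_faces_eq ε hlam]
    refine Finset.sum_congr rfl fun i _ => ?_
    rw [crossingChain_eq (hcol C C' hC q hq i).1, crossingChain_eq (hcol C C' hC q hq i).2,
      hs, hs', ← apply_ite (fun w => Finsupp.single w (1 : ℤ)),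
      ← apply_ite (fun w => Finsupp.single w (1 : ℤ))]
  · have h1 : ∀ w ∈ crossings f, shadowMap f (w 0) ∉ R.K →
        shadowCrossingChain C' w = shadowCrossingChain C w := fun w hw hK =>
      R.agreeOutside.shadowCrossingChain_eq hC.1 hC.2 (shadowMap_notMem_of_mem_crossings hw hK)
    have hq := R.isShadowLabel_iff.1 hq
    have hb := fun i => HasChamberColour.beyond R hn hC i hq.2 (R.isLabel_iff.1 hq.1 i)
    unfold shadowChain
    rw [finsum_crossings_sub R hf hf' h1 hxinj hxinj' hxU hxU', boundary_single]
    rw [boundaryGen_eq_neg_sum, smul_neg, ← neg_smul, ← sum_faces_eq ε hlam]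
    refine Finset.sum_congr rfl fun i _ => ?_
    have e1 := R.isSourceChamberColour_iff_eq neg_one_mem R.F_start hq.2.1
      (q := Fin.tail q) (fun i => (hb i).1) (hx i)
    have e2 := R.isSourceChamberColour_iff_eq one_mem R.F_end hq.2.2
      (q := Fin.tail q) (fun i => (hb i).2) (hx' i)
    have e3 := hcol C.toColouring C'.toColouring hC.1 _ hq.1 i
    rw [shadowCrossingChain_eq
        (q := if 0 < -1 * timeCoeff R.L R.b i then faceStar i.succ q else faceZero i.succ q) ?_ ?_,
      shadowCrossingChain_eq
        (q := if 0 < 1 * timeCoeff R.L R.b i then faceStar i.succ q else faceZero i.succ q) ?_ ?_,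
      hs, hs', ← apply_ite (fun w => Finsupp.single w (1 : ℤ)),
      ← apply_ite (fun w => Finsupp.single w (1 : ℤ))]
    · intro q'
      rw [e3.2, faceZero_succ, faceStar_succ]
      split_ifs <;> rw [Fin.tail_cons]
    · intro q'
      rw [e2, faceZero_succ, faceStar_succ]
      split_ifs <;> exact Iff.rfl
    · intro q'
      rw [e3.1, faceZero_succ, faceStar_succ]
      split_ifs <;> rw [Fin.tail_cons]
    · intro q'
      rw [e1, faceZero_succ, faceStar_succ]
      split_ifs <;> exact Iff.rfl

end PassMove

end Manifold

end PassMoveLemma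

end

open PassMoveLemma in
theorem lemma4p2 {n : ℕ} (hn : 1 ≤ n) {M : Type*} [TopologicalSpace M] [ChartedSpace (E n) M]
    [IsManifold (𝓡 n) ∞ M] [T2Space M] [CompactSpace M] (o : ManifoldOrientation n M)
    {X : Type*} [Quandle X] (f f' : M → E (n + 2)) (hf : IsRegular o f) (hf' : IsRegular o f')
    (R : PassMove o f f') :
    (∃ ε : ℤˣ, ∀ (C : Colouring o f X) (C' : Colouring o f' X), R.Corresponds C C' →
      (∃! q : Fin (n + 2) → X, R.IsLabel C C' q) ∧
      (∀ q : Fin (n + 2) → X, R.IsLabel C C' q →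
        chain C - chain C' = (ε : ℤ) • boundary X (n + 1) (Finsupp.single q 1)) ∧
      QuandleHomologous (chain C) (chain C') ∧
      ∀ (hC : IsQuandleCycle (chain C)) (hC' : IsQuandleCycle (chain C')),
        homologyClass (chain C) hC = homologyClass (chain C') hC') ∧
    (∃ ε : ℤˣ, ∀ (C : ShadowColouring o f X) (C' : ShadowColouring o f' X),
      R.ShadowCorresponds C C' →
      (∃! q : Fin (n + 3) → X, R.IsShadowLabel C C' q) ∧
      (∀ q : Fin (n + 3) → X, R.IsShadowLabel C C' q →
        shadowChain C - shadowChain C' =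
          (ε : ℤ) • boundary X (n + 2) (Finsupp.single q 1)) ∧
      QuandleHomologous (shadowChain C) (shadowChain C') ∧
      ∀ (hC : IsQuandleCycle (shadowChain C)) (hC' : IsQuandleCycle (shadowChain C')),
        homologyClass (shadowChain C) hC = homologyClass (shadowChain C') hC') := by
  obtain ⟨ε, h, hsh⟩ := R.exists_chain_sub_eq hn hf hf' X
  refine ⟨⟨-ε, fun C C' hC => ?_⟩, ⟨ε, fun C C' hC => ?_⟩⟩
  · have hex := R.existsUnique_isLabel hn hC
    obtain ⟨q, hqq, -⟩ := R.existsUnique_isLabel hn hC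
    have hom := quandleHomologous_of_sub_eq (h C C' hC q hqq)
    refine ⟨hex, fun q hq => ?_, hom, hom.homologyClass_eq⟩
    rw [h C C' hC q hq, Units.val_neg]
  · have hex := R.existsUnique_isShadowLabel hn hC
    obtain ⟨q, hqq, -⟩ := R.existsUnique_isShadowLabel hn hC
    have hom := quandleHomologous_of_sub_eq (hsh C C' hC q hqq)
    exact ⟨hex, hsh C C' hC, hom, hom.homologyClass_eq⟩
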